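/- Let $S$ be a finite non-empty set and let $p:2^S\to\mathbb Z\cup\{-\infty\}$ be supermodular (that is, $p(X)+p(Y)\le p(X\cap Y)+p(X\cup Y)$ for all $X,Y\subseteq S$ for which $p(X)$ and $p(Y)$ are finite), with $p(\emptyset)=0$ and $p(S)$ finite. For $x\in\mathbb R^S$ and $Z\subseteq S$ write $\widetilde x(Z)=\sum_{s\in Z}x(s)$. The integral base-polyhedron defined by $p$ is $$B=B'(p)=\{x\in\mathbb R^S:\ \widetilde x(S)=p(S),\ \widetilde x(Z)\ge p(Z)\text{ for all }Z\subseteq S\};$$ the same notation is used for set-functions on subsets of $S$. The set of integral elements of a polyhedron $P$ is denoted by $\dot P$; an M-convex set is a set of the form $\dot P$ where $P$ is an integral base-polyhedron, that is, a set $P=B'(p')$ with $p'$ of the above kind. A vector $m\in Q\subseteq\mathbb Z^S$ is decreasingly minimal (dec-min) in $Q$ if for every $y\in Q$ the vector $m{\downarrow}$ (the components of $m$ in decreasing order) is equal to or lexicographically smaller than $y{\downarrow}$. Define iteratively $C_0=\emptyset$ and, as long as $C_{j-1}\ne S$, $$\beta_j=\max\Big\{\Big\lceil\tfrac{p(X\cup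 C_{j-1})-p(C_{j-1})}{|X|}\Big\rceil:\ \emptyset\ne X\subseteq S-C_{j-1}\Big\},$$ $$h_j(X)=p(X\cup C_{j-1})-p(C_{j-1})-(\beta_j-1)|X|\qquad(X\subseteq S-C_{j-1});$$ let $S_j$ (the peak-set) be the smallest maximizer of $h_j$, that is, the intersection of all maximizers of $h_j$, and let $C_j=C_{j-1}\cup S_j$. Then this procedure terminates with $C_q=S$ for some $q$; the sets $S_1,\dots,S_q$ are non-empty and form a partition of $S$ (the canonical partition), and $\beta_1>\beta_2>\cdots>\beta_q$ (the essential value-sequence). Moreover, put $$B^{\oplus}=\{x\in B:\ \widetilde x(C_i)=p(C_i)\ (i=1,\dots,q)\},\quad T^*=\{x\in\mathbb R^S:\ \beta_i-1\le x(s)\le\beta_i\ (s\in S_i,\ i=1,\dots,q)\},\quad B^\bullet=B^\oplus\cap T^*,$$ and, for $i=1,\dots,q$, $p_i(X)=p(X\cup C_{i-1})-p(C_{i-1})$ for $X\subseteq S_i$, $B_i=B'(p_i)\subseteq\mathbb R^{S_i}$ and $T_i=\{x\in\mathbb R^{S_i}:\beta_i-1\le x(s)\le\beta_i\ (s\in S_i)\}$.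 Then: 1. The set of dec-min elements of $\dot B$ is $\dot B^\bullet$. Here $B^\bullet$ is a (non-empty) integral base-polyhedron, so $\dot B^\bullet$ is an M-convex set. 2. Equivalently, $m\in\mathbb Z^S$ is a dec-min element of $\dot B$ if and only if its restriction $m|S_i$ belongs to $B_i\cap T_i$ for each $i=1,\dots,q$. 3. An element $m\in\dot B$ is dec-min in $\dot B$ if and only if each $C_i$ is $m$-tight, that is, $\widetilde m(C_i)=p(C_i)$, and $\beta_i-1\le m(s)\le\beta_i$ for every $s\in S_i$ $(i=1,\dots,q)$. -/

import Mathlib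

namespace DecMin

section SetFunctions

variable {S : Type*} [Fintype S] [DecidableEq S]

/-- An integer-valued (fully) supermodular set-function `p` on the ground-set `S`, where the value
`-∞` (that is, `⊥`) is allowed, with `p(∅) = 0` and `p(S)` finite. In `WithBot ℤ` the inequality is
automatic when `p X` or `p Y` is `⊥`, so it is required only for sets with finite values. -/
structure IsSupermodular (p : Finset S → WithBot ℤ) : Prop where
  map_empty : p ∅ = 0
  map_univ_ne_bot : p Finset.univ ≠ ⊥
  add_le : ∀ X Y : Finset S, p X + p Y ≤ p (X ∩ Y) + p (X ∪ Y)

/-- The base-polyhedron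
`B'(p) = {x ∈ ℝ^S : x(S) = p(S) and x(Z) ≥ p(Z) for every Z ⊆ S}`. -/
def basePolyhedron (p : Finset S → WithBot ℤ) : Set (S → ℝ) :=
  {x | ((∑ s, x s : ℝ) : WithBot ℝ) = (p Finset.univ).map (fun k : ℤ => (k : ℝ)) ∧
    ∀ Z : Finset S, (p Z).map (fun k : ℤ => (k : ℝ)) ≤ ((∑ s ∈ Z, x s : ℝ) : WithBot ℝ)}

/-- The set of integral elements of a set of real vectors. -/
def integralPoints (B : Set (S → ℝ)) : Set (S → ℤ) :=
  {m | (fun s => (m s : ℝ)) ∈ B}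

/-- A (non-empty) integral base-polyhedron: a set `B'(p)` with `p` integer-valued supermodular. -/
def IsIntegralBasePolyhedron (B : Set (S → ℝ)) : Prop :=
  ∃ p : Finset S → WithBot ℤ, IsSupermodular p ∧ B = basePolyhedron p

/-- An M-convex set: the set of integral elements of an integral base-polyhedron. -/
def IsMConvexSet (Q : Set (S → ℤ)) : Prop :=
  ∃ B : Set (S → ℝ), IsIntegralBasePolyhedron B ∧ Q = integralPoints B

/-- A set `X` is `m`-tight (with respect to `p`) if `m(X) = p(X)`. -/
def IsTight (p : Finset S → WithBot ℤ) (m : S → ℤ) (X : Finset S) : Prop :=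
  ((∑ s ∈ X, m s : ℤ) : WithBot ℤ) = p X

/-- The contraction `p / Z`, a set-function on `S - Z`: `X ↦ p (X ∪ Z) - p Z`
(used when `p Z` is finite). -/
def contract (p : Finset S → WithBot ℤ) (Z : Finset S) :
    Finset {s : S // s ∉ Z} → WithBot ℤ :=
  fun X => (p (X.map (Function.Embedding.subtype _) ∪ Z)).map
    (fun k : ℤ => k - (p Z).unbotD 0)

/-- `max {⌈p(X) / |X|⌉ : ∅ ≠ X ⊆ S}`. The value for an empty ground-set is a dummy. -/
def beta (p : Finset S → WithBot ℤ) : ℤ :=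
  (((Finset.univ : Finset (Finset S)).filter (fun X => X.Nonempty)).sup
    (fun X => (p X).map (fun k : ℤ => ⌈(k : ℚ) / (X.card : ℚ)⌉))).unbotD 0

/-- The set-function `h(X) = p(X) - (β - 1)|X|`, where `β = max {⌈p(X) / |X|⌉ : ∅ ≠ X ⊆ S}`. -/
def peakFun (p : Finset S → WithBot ℤ) (X : Finset S) : WithBot ℤ :=
  (p X).map (fun k : ℤ => k - (beta p - 1) * (X.card : ℤ))

/-- The peak-set of `S` assigned to `B'(p)`: the smallest maximizer of `h`, that is, the
intersection of all sets maximizing `h`. -/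
def peakSet (p : Finset S → WithBot ℤ) : Finset S :=
  Finset.univ.filter
    (fun s => ∀ X : Finset S, (∀ Y : Finset S, peakFun p Y ≤ peakFun p X) → s ∈ X)

end SetFunctions

section DecMinimality

variable {S : Type*} [Fintype S]

/-- `x↓`: the list of the components of `x` in decreasing order. -/
def sortDown (x : S → ℤ) : List ℤ :=
  ((Finset.univ : Finset S).val.map x).sort (fun a b => b ≤ a)

/-- `x` is decreasingly smaller than `y`: `x↓` is lexicographically smaller than `y↓`. -/
def DecLT (x y : S → ℤ) : Prop :=
  List.Lex (fun a b : ℤ => a < b) (sortDown x) (sortDown y)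

/-- `x` is decreasingly smaller than `y` or value-equivalent to `y`. -/
def DecLE (x y : S → ℤ) : Prop :=
  DecLT x y ∨ sortDown x = sortDown y

/-- The set of decreasingly minimal elements of `Q`. -/
def decMinSet (Q : Set (S → ℤ)) : Set (S → ℤ) :=
  {x | x ∈ Q ∧ ∀ y ∈ Q, DecLE x y}

end DecMinimality

section Canonical

variable {S : Type*} [Fintype S] [DecidableEq S]

/-- The canonical chain `∅ = C₀ ⊂ C₁ ⊂ ⋯ ⊂ C_q = S`: the set `C_{j+1}` arises from `C_j` by adding
the peak-set of `S - C_j` assigned to the base-polyhedron `B'(p / C_j)`. -/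
def canonicalChain (p : Finset S → WithBot ℤ) : ℕ → Finset S
  | 0 => ∅
  | j + 1 => canonicalChain p j ∪
      (peakSet (contract p (canonicalChain p j))).map (Function.Embedding.subtype _)

/-- The number `q` of iterations: the first index with `C_q = S`. -/
noncomputable def canonicalLength (p : Finset S → WithBot ℤ) : ℕ :=
  sInf {j | canonicalChain p j = Finset.univ}

/-- The members of the canonical partition, indexed from `0`: `canonicalPart p i` is
`S_{i+1} = C_{i+1} - C_i`, for `i < q`. -/
def canonicalPart (p : Finset S → WithBot ℤ) (i : ℕ) : Finset S :=
  canonicalChain p (i + 1) \ canonicalChain p i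

/-- The essential value-sequence, indexed from `0`: `essentialValue p i` is
`β_{i+1} = max {⌈(p(X ∪ C_i) - p(C_i)) / |X|⌉ : ∅ ≠ X ⊆ S - C_i}`, for `i < q`. -/
def essentialValue (p : Finset S → WithBot ℤ) (i : ℕ) : ℤ :=
  beta (contract p (canonicalChain p i))

/-- The set-function `X ↦ p (X ∪ C_i) - p(C_i)` on the part `S_{i+1}`. -/
def partFun (p : Finset S → WithBot ℤ) (i : ℕ) :
    Finset {s : S // s ∈ canonicalPart p i} → WithBot ℤ :=
  fun X => (p (X.map (Function.Embedding.subtype _) ∪ canonicalChain p i)).map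
    (fun k : ℤ => k - (p (canonicalChain p i)).unbotD 0)

/-- The small box `{x ∈ ℝ^{S_{i+1}} : β_{i+1} - 1 ≤ x(s) ≤ β_{i+1} for s ∈ S_{i+1}}`. -/
def partBox (p : Finset S → WithBot ℤ) (i : ℕ) :
    Set ({s : S // s ∈ canonicalPart p i} → ℝ) :=
  {x | ∀ s, (essentialValue p i : ℝ) - 1 ≤ x s ∧ x s ≤ (essentialValue p i : ℝ)}

/-- `B^⊕`: the face of `B'(p)` defined by the canonical chain. -/
def canonicalFace (p : Finset S → WithBot ℤ) : Set (S → ℝ) :=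
  {x | x ∈ basePolyhedron p ∧ ∀ i < canonicalLength p,
    ((∑ s ∈ canonicalChain p (i + 1), x s : ℝ) : WithBot ℝ) =
      (p (canonicalChain p (i + 1))).map (fun k : ℤ => (k : ℝ))}

/-- The box `T*`, the direct sum of the small boxes of the parts. -/
def canonicalBox (p : Finset S → WithBot ℤ) : Set (S → ℝ) :=
  {x | ∀ i < canonicalLength p, ∀ s ∈ canonicalPart p i,
    (essentialValue p i : ℝ) - 1 ≤ x s ∧ x s ≤ (essentialValue p i : ℝ)}

/-- `B^• = B^⊕ ∩ T*`. -/
def bulletPolyhedron (p : Finset S → WithBot ℤ) : Set (S → ℝ) :=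
  canonicalFace p ∩ canonicalBox p

end Canonical

end DecMin

/-! With K = |S| + 1, comparing integer vectors decreasingly is the same as comparing the separable
convex weight ∑ K ^ x(s) (`decLE_iff_rapidWeight_le`), so dec-min elements are exactly the
minimizers of this weight.

A lower bound for the weight comes from chords. On the i-th part, K ^ t is at least the chord
through t = β_i - 1 and t = β_i, with equality at an integer t only for these two values. What
remains is a linear function of m whose slopes decrease strictly along the partition. Abel summation
rewrites it as a constant plus a positive combination of the excesses m(C_i) - p(C_i), 0 < i < q,
which are nonnegative on B. The weight is thus at least a constant, attained exactly when every C_i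
is tight and m lies in the box (`PeakChain.minWeight_le`).

The bound must also be attained. The face B^⊕ is the base-polyhedron of a direct sum of minors of p
(`PeakChain.basePolyhedron_faceFun`). Its intersection with T* is the base-polyhedron of a
finite-valued supermodular function (`basePolyhedron_boxFun`), provided two inequalities relating
the minors to the box hold. These are what the canonical partition supplies: the definition of β_i
gives one and the maximality of the peak-set the other, as recorded in `PeakChain`. The greedy
algorithm then finds an integral point (`exists_integer_base`). Only the maximality of the peak-set
for h_i is used, not that it is the smallest maximizer. -/

namespace DecMin

/-! ### Arithmetic with the value -∞ -/

section WithBotInt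

lemma exists_coe_of_ne_bot {α : Type*} {w : WithBot α} (h : w ≠ ⊥) : ∃ k : α, w = k :=
  ⟨w.unbot h, (WithBot.coe_unbot w h).symm⟩

lemma map_sub_eq_add (w : WithBot ℤ) (c : ℤ) :
    w.map (fun k : ℤ => k - c) = w + ((-c : ℤ) : WithBot ℤ) := by
  induction w with
  | bot => rfl
  | coe k => simp only [WithBot.map_coe, ← WithBot.coe_add, sub_eq_add_neg]

lemma map_cast_le_iff {w : WithBot ℤ} {r : ℝ} :
    w.map (fun k : ℤ => (k : ℝ)) ≤ (r : WithBot ℝ) ↔ ∀ k : ℤ, w = k → (k : ℝ) ≤ r := by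
  induction w with
  | bot => simp
  | coe j => simp

lemma coe_eq_map_cast_iff {w : WithBot ℤ} {r : ℝ} (hw : w ≠ ⊥) :
    (r : WithBot ℝ) = w.map (fun k : ℤ => (k : ℝ)) ↔ ∀ k : ℤ, w = k → r = k := by
  induction w with
  | bot => exact absurd rfl hw
  | coe j => simp

lemma exists_of_sum_eq_coe {ι : Type*} (s : Finset ι) (F : ι → WithBot ℤ) {k : ℤ}
    (h : ∑ i ∈ s, F i = k) : ∃ κ : ι → ℤ, (∀ i ∈ s, F i = κ i) ∧ ∑ i ∈ s, κ i = k := by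
  have hne : ∀ i ∈ s, F i ≠ ⊥ := by
    intro i hi hb
    rw [WithBot.sum_eq_bot_iff.mpr ⟨i, hi, hb⟩] at h
    exact WithBot.bot_ne_coe h
  have hF : ∀ i ∈ s, F i = ((F i).unbotD 0 : ℤ) := by
    intro i hi
    obtain ⟨a, ha⟩ := exists_coe_of_ne_bot (hne i hi)
    rw [ha, WithBot.unbotD_coe]
  refine ⟨fun i => (F i).unbotD 0, hF, ?_⟩
  rw [Finset.sum_congr rfl hF, ← WithBot.coe_sum] at h
  exact WithBot.coe_injective h

end WithBotInt

section Supermodular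

variable {S : Type*} [Fintype S] [DecidableEq S] {p : Finset S → WithBot ℤ}

lemma IsSupermodular.exists_coe (hp : IsSupermodular p) {X Y : Finset S} {a b : ℤ}
    (ha : p X = a) (hb : p Y = b) :
    ∃ c d : ℤ, p (X ∩ Y) = c ∧ p (X ∪ Y) = d ∧ a + b ≤ c + d := by
  have h := hp.add_le X Y
  rw [ha, hb, ← WithBot.coe_add] at h
  have h1 : p (X ∩ Y) + p (X ∪ Y) ≠ ⊥ := fun hh => by
    rw [hh] at h
    exact WithBot.coe_ne_bot (le_bot_iff.mp h)
  rw [Ne, WithBot.add_eq_bot, not_or] at h1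
  obtain ⟨c, hc⟩ := exists_coe_of_ne_bot h1.1
  obtain ⟨d, hd⟩ := exists_coe_of_ne_bot h1.2
  rw [hc, hd, ← WithBot.coe_add, WithBot.coe_le_coe] at h
  exact ⟨c, d, hc, hd, h⟩

omit [DecidableEq S] in
lemma mem_basePolyhedron_iff (hp : p Finset.univ ≠ ⊥) {x : S → ℝ} :
    x ∈ basePolyhedron p ↔ (∀ k : ℤ, p Finset.univ = k → ∑ s, x s = k) ∧
      ∀ (Z : Finset S) (k : ℤ), p Z = k → (k : ℝ) ≤ ∑ s ∈ Z, x s := by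
  simp only [basePolyhedron, Set.mem_ofPred_eq, coe_eq_map_cast_iff hp, map_cast_le_iff]

end Supermodular

/-! ### The number β and the peak-set of a supermodular function -/

section Peak

variable {S : Type*} [Fintype S] {p : Finset S → WithBot ℤ}

/-- The set S itself contributes a finite quotient, so the default value in `beta` is never used. -/
lemma coe_beta_eq_sup [Nonempty S] (hS : p Finset.univ ≠ ⊥) :
    (beta p : WithBot ℤ) = ((Finset.univ : Finset (Finset S)).filter (fun X => X.Nonempty)).sup
      (fun X => (p X).map (fun k : ℤ => ⌈(k : ℚ) / (X.card : ℚ)⌉)) := by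
  obtain ⟨k, hk⟩ := exists_coe_of_ne_bot hS
  have h : ((Finset.univ : Finset (Finset S)).filter (fun X => X.Nonempty)).sup
      (fun X => (p X).map (fun k : ℤ => ⌈(k : ℚ) / (X.card : ℚ)⌉)) ≠ ⊥ := by
    intro hb
    have h1 := Finset.le_sup (f := fun X : Finset S =>
      (p X).map (fun k : ℤ => ⌈(k : ℚ) / (X.card : ℚ)⌉))
      (Finset.mem_filter.mpr ⟨Finset.mem_univ _, (Finset.univ_nonempty : (Finset.univ : Finset S).Nonempty)⟩)
    rw [hb, hk, WithBot.map_coe] at h1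
    exact WithBot.coe_ne_bot (le_bot_iff.mp h1)
  obtain ⟨b, hb⟩ := exists_coe_of_ne_bot h
  rw [beta, hb, WithBot.unbotD_coe]

lemma le_beta_mul_card [Nonempty S] (hS : p Finset.univ ≠ ⊥) (h0 : p ∅ = 0) {X : Finset S} {k : ℤ}
    (hk : p X = k) : k ≤ beta p * X.card := by
  rcases X.eq_empty_or_nonempty with rfl | hX
  · rw [h0] at hk
    have : (0 : ℤ) = k := WithBot.coe_injective hk
    simp [← this]
  · have h1 := Finset.le_sup (f := fun X : Finset S =>
      (p X).map (fun k : ℤ => ⌈(k : ℚ) / (X.card : ℚ)⌉))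
      (Finset.mem_filter.mpr ⟨Finset.mem_univ _, hX⟩)
    rw [← coe_beta_eq_sup hS, hk, WithBot.map_coe, WithBot.coe_le_coe, Int.ceil_le,
      div_le_iff₀ (by exact_mod_cast hX.card_pos)] at h1
    exact_mod_cast h1

lemma beta_le_of_forall [Nonempty S] (hS : p Finset.univ ≠ ⊥) {b : ℤ}
    (h : ∀ (X : Finset S) (k : ℤ), X.Nonempty → p X = k → k ≤ b * X.card) : beta p ≤ b := by
  rw [← WithBot.coe_le_coe, coe_beta_eq_sup hS]
  refine Finset.sup_le fun X hX => ?_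
  have hX' := (Finset.mem_filter.mp hX).2
  rcases hk : p X with _ | k
  · exact bot_le
  · refine WithBot.coe_le_coe.mpr ?_
    rw [Int.ceil_le, div_le_iff₀ (by exact_mod_cast hX'.card_pos)]
    exact_mod_cast h X k hX' hk

lemma exists_beta_pred_mul_card_lt [Nonempty S] (hS : p Finset.univ ≠ ⊥) :
    ∃ (X : Finset S) (k : ℤ), p X = k ∧ (beta p - 1) * X.card < k := by
  by_contra! h
  have := beta_le_of_forall hS (b := beta p - 1) fun X k _ hk => h X k hk
  omega

lemma peakFun_eq_add (p : Finset S → WithBot ℤ) (X : Finset S) :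
    peakFun p X = p X + ((-((beta p - 1) * (X.card : ℤ)) : ℤ) : WithBot ℤ) :=
  map_sub_eq_add _ _

variable [DecidableEq S]

lemma peakFun_add_le (hp : IsSupermodular p) (X Y : Finset S) :
    peakFun p X + peakFun p Y ≤ peakFun p (X ∩ Y) + peakFun p (X ∪ Y) := by
  simp only [peakFun_eq_add]
  rw [add_add_add_comm, add_add_add_comm (p (X ∩ Y)), ← WithBot.coe_add, ← WithBot.coe_add]
  have h : ((X ∩ Y).card : ℤ) + (X ∪ Y).card = X.card + Y.card := by
    exact_mod_cast Finset.card_inter_add_card_union X Y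
  have h2 : -((beta p - 1) * ((X ∩ Y).card : ℤ)) + -((beta p - 1) * ((X ∪ Y).card : ℤ)) =
      -((beta p - 1) * (X.card : ℤ)) + -((beta p - 1) * (Y.card : ℤ)) := by
    linear_combination (-(beta p - 1)) * h
  rw [h2]
  exact add_le_add (hp.add_le X Y) le_rfl

/-- The maximizers of a supermodular function are closed under intersection, so a maximizer of least
cardinality lies in all others and equals their intersection. -/
lemma peakFun_le_peakSet (hp : IsSupermodular p) (X : Finset S) :
    peakFun p X ≤ peakFun p (peakSet p) := by
  classical
  set M : Finset (Finset S) := Finset.univ.filter fun X => ∀ Y, peakFun p Y ≤ peakFun p X with hM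
  have hMne : M.Nonempty := by
    obtain ⟨X, hX⟩ := Finite.exists_max (peakFun p)
    exact ⟨X, by simpa [hM] using hX⟩
  obtain ⟨X₀, hX₀, hmin⟩ := Finset.exists_min_image M Finset.card hMne
  have hX₀' : ∀ Y, peakFun p Y ≤ peakFun p X₀ := by simpa [hM] using hX₀
  have hsub : ∀ Y : Finset S, (∀ Z, peakFun p Z ≤ peakFun p Y) → X₀ ⊆ Y := by
    intro Y hY
    have heq : peakFun p Y = peakFun p X₀ := le_antisymm (hX₀' _) (hY _)
    have h := peakFun_add_le hp X₀ Y
    have hne : peakFun p X₀ ≠ ⊥ := by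
      intro hb
      have h0 := hX₀' ∅
      rw [hb, peakFun_eq_add, hp.map_empty, le_bot_iff, WithBot.add_eq_bot] at h0
      rcases h0 with h0 | h0 <;> exact WithBot.coe_ne_bot h0
    obtain ⟨μ, hμ⟩ := exists_coe_of_ne_bot hne
    -- The union has value at most the maximum, which is finite and can be cancelled.
    have hle : peakFun p X₀ ≤ peakFun p (X₀ ∩ Y) := by
      have h3 : peakFun p X₀ + peakFun p X₀ ≤ peakFun p (X₀ ∩ Y) + peakFun p X₀ := by
        calc _ = peakFun p X₀ + peakFun p Y := by rw [heq]
          _ ≤ _ := h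
          _ ≤ _ := by gcongr; exact hX₀' _
      exact (WithBot.add_le_add_iff_right hne).mp h3
    have hmem : X₀ ∩ Y ∈ M := by
      simp only [hM, Finset.mem_filter, Finset.mem_univ, true_and]
      exact fun Z => (hX₀' Z).trans hle
    rw [← Finset.inter_eq_left]
    exact Finset.eq_of_subset_of_card_le Finset.inter_subset_left (hmin _ hmem)
  have hpeak : peakSet p = X₀ := by
    ext s
    simp only [peakSet, Finset.mem_filter, Finset.mem_univ, true_and]
    exact ⟨fun h => h X₀ hX₀', fun h X hX => hsub X hX h⟩
  rw [hpeak]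
  exact hX₀' X

lemma map_peakSet_ne_bot (hp : IsSupermodular p) : p (peakSet p) ≠ ⊥ := by
  intro hb
  have h := peakFun_le_peakSet hp ∅
  rw [peakFun_eq_add, peakFun_eq_add, hp.map_empty, hb, WithBot.bot_add, le_bot_iff,
    WithBot.add_eq_bot] at h
  rcases h with h | h <;> exact WithBot.coe_ne_bot h

lemma sub_le_peakSet (hp : IsSupermodular p) {X : Finset S} {k l : ℤ} (hk : p X = k)
    (hl : p (peakSet p) = l) :
    k - (beta p - 1) * X.card ≤ l - (beta p - 1) * (peakSet p).card := by
  have h := peakFun_le_peakSet hp X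
  rw [peakFun, peakFun, hk, hl] at h
  simpa using h

/-- By minimality of β the function h is positive somewhere, whereas h(∅) = 0. -/
lemma peakSet_nonempty [Nonempty S] (hp : IsSupermodular p) : (peakSet p).Nonempty := by
  rw [Finset.nonempty_iff_ne_empty]
  intro he
  obtain ⟨X, k, hk, hlt⟩ := exists_beta_pred_mul_card_lt hp.map_univ_ne_bot
  have := sub_le_peakSet hp hk (l := 0) (by rw [he, hp.map_empty]; rfl)
  rw [he] at this
  simp at this
  omega

end Peak

end DecMin

namespace DecMin

/-! ### One step of the iteration, in terms of subsets of S -/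

section Contraction

variable {S : Type*} [Fintype S] [DecidableEq S] {p : Finset S → WithBot ℤ}

omit [Fintype S] in
lemma contract_apply {C : Finset S} {c : ℤ} (hc : p C = c) (X : Finset {s : S // s ∉ C}) :
    contract p C X = p (X.map (Function.Embedding.subtype _) ∪ C) + ((-c : ℤ) : WithBot ℤ) := by
  rw [contract, hc, WithBot.unbotD_coe, map_sub_eq_add]

omit [Fintype S] in
lemma contract_eq_coe_iff {C : Finset S} {c k : ℤ} (hc : p C = c) (X : Finset {s : S // s ∉ C}) :
    contract p C X = k ↔ p (X.map (Function.Embedding.subtype _) ∪ C) = ((k + c : ℤ) : WithBot ℤ) := by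
  rw [contract_apply hc]
  cases p (X.map (Function.Embedding.subtype _) ∪ C) with
  | bot => simp only [WithBot.bot_add, WithBot.bot_ne_coe]
  | coe j =>
    rw [← WithBot.coe_add, WithBot.coe_inj, WithBot.coe_inj]
    constructor <;> intro h <;> omega

lemma isSupermodular_contract (hp : IsSupermodular p) {C : Finset S} {c : ℤ} (hc : p C = c) :
    IsSupermodular (contract p C) where
  map_empty := by
    refine (contract_eq_coe_iff (k := 0) hc ∅).mpr ?_
    rw [Finset.map_empty, Finset.empty_union, hc, zero_add]
  map_univ_ne_bot := by
    have h : (Finset.univ : Finset {s : S // s ∉ C}).map (Function.Embedding.subtype _) ∪ C =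
        Finset.univ := by
      ext s
      simp [em']
    rw [contract_apply hc, h, Ne, WithBot.add_eq_bot, not_or]
    exact ⟨hp.map_univ_ne_bot, WithBot.coe_ne_bot⟩
  add_le X Y := by
    simp only [contract_apply hc]
    rw [Finset.map_inter, Finset.map_union, Finset.inter_union_distrib_right,
      Finset.union_union_distrib_right]
    exact (add_add_add_comm _ _ _ _).trans_le
      ((add_le_add (hp.add_le _ _) le_rfl).trans_eq (add_add_add_comm _ _ _ _))

omit [Fintype S] in
lemma exists_map_subtype_eq {C X : Finset S} (h : Disjoint X C) :
    ∃ Y : Finset {s : S // s ∉ C}, Y.map (Function.Embedding.subtype _) = X :=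
  ⟨X.subtype _, by
    rw [Finset.subtype_map, Finset.filter_eq_self]
    exact fun s hs => Finset.disjoint_left.mp h hs⟩

/-- The peak-set of `S - C` assigned to the contraction `p / C`, as a subset of `S`. -/
def peakAbove (p : Finset S → WithBot ℤ) (C : Finset S) : Finset S :=
  (peakSet (contract p C)).map (Function.Embedding.subtype _)

lemma disjoint_peakAbove (p : Finset S → WithBot ℤ) (C : Finset S) : Disjoint (peakAbove p C) C := by
  rw [Finset.disjoint_left]
  intro s hs
  obtain ⟨t, _, rfl⟩ := Finset.mem_map.mp hs
  exact t.2

lemma nonempty_compl_subtype {C : Finset S} (h : C ≠ Finset.univ) : Nonempty {s : S // s ∉ C} := by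
  by_contra hn
  exact h (Finset.eq_univ_iff_forall.mpr fun s => by
    by_contra hs
    exact hn ⟨⟨s, hs⟩⟩)

lemma peakAbove_nonempty (hp : IsSupermodular p) {C : Finset S} {c : ℤ} (hc : p C = c)
    (h : C ≠ Finset.univ) : (peakAbove p C).Nonempty := by
  have := nonempty_compl_subtype h
  exact (peakSet_nonempty (isSupermodular_contract hp hc)).map

lemma map_union_peakAbove_ne_bot (hp : IsSupermodular p) {C : Finset S} {c : ℤ} (hc : p C = c) :
    p (C ∪ peakAbove p C) ≠ ⊥ := by
  have h := map_peakSet_ne_bot (isSupermodular_contract hp hc)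
  rw [contract_apply hc, Ne, WithBot.add_eq_bot, not_or] at h
  rw [Finset.union_comm]
  exact h.1

lemma sub_le_beta_contract (hp : IsSupermodular p) {C X : Finset S} {c k : ℤ} (hc : p C = c)
    (h : C ≠ Finset.univ) (hX : Disjoint X C) (hk : p (X ∪ C) = k) :
    k - c ≤ beta (contract p C) * X.card := by
  have := nonempty_compl_subtype h
  obtain ⟨Y, rfl⟩ := exists_map_subtype_eq hX
  have hs := isSupermodular_contract hp hc
  have hY : contract p C Y = ((k - c : ℤ) : WithBot ℤ) := by
    rw [contract_eq_coe_iff hc, hk, sub_add_cancel]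
  simpa using le_beta_mul_card hs.map_univ_ne_bot hs.map_empty hY

lemma sub_le_peakAbove (hp : IsSupermodular p) {C X : Finset S} {c k l : ℤ} (hc : p C = c)
    (hX : Disjoint X C) (hk : p (X ∪ C) = k) (hl : p (C ∪ peakAbove p C) = l) :
    k - (beta (contract p C) - 1) * X.card ≤
      l - (beta (contract p C) - 1) * (peakAbove p C).card := by
  obtain ⟨Y, rfl⟩ := exists_map_subtype_eq hX
  have hs := isSupermodular_contract hp hc
  have hY : contract p C Y = ((k - c : ℤ) : WithBot ℤ) := by
    rw [contract_eq_coe_iff hc, hk, sub_add_cancel]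
  have hP : contract p C (peakSet (contract p C)) = ((l - c : ℤ) : WithBot ℤ) := by
    rw [contract_eq_coe_iff hc, sub_add_cancel, ← hl, Finset.union_comm, peakAbove]
  have := sub_le_peakSet hs hY hP
  rw [peakAbove, Finset.card_map, Finset.card_map]
  linarith

/-- Enlarging the peak-set by a set Z cannot increase h, so the marginal value of Z over the new C
is at most (β - 1)|Z|; hence the next β is at most β - 1. -/
lemma beta_contract_union_peakAbove_lt (hp : IsSupermodular p) {C : Finset S} {c : ℤ} (hc : p C = c)
    (h : C ∪ peakAbove p C ≠ Finset.univ) :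
    beta (contract p (C ∪ peakAbove p C)) < beta (contract p C) := by
  have := nonempty_compl_subtype h
  obtain ⟨l, hl⟩ := exists_coe_of_ne_bot (map_union_peakAbove_ne_bot hp hc)
  refine Int.lt_of_le_sub_one (beta_le_of_forall (isSupermodular_contract hp hl).map_univ_ne_bot ?_)
  intro X k _ hk
  rw [contract_eq_coe_iff hl] at hk
  set Z := X.map (Function.Embedding.subtype _) with hZ
  have hdZ : Disjoint Z (C ∪ peakAbove p C) := by
    rw [Finset.disjoint_left]
    intro s hs
    obtain ⟨t, _, rfl⟩ := Finset.mem_map.mp hs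
    exact t.2
  have hdZ' := Finset.disjoint_union_right.mp hdZ
  have h1 := sub_le_peakAbove hp (X := Z ∪ peakAbove p C) hc
    (Finset.disjoint_union_left.mpr ⟨hdZ'.1, disjoint_peakAbove p C⟩)
    (by rw [Finset.union_assoc, Finset.union_comm (peakAbove p C)]; exact hk) hl
  rw [Finset.card_union_of_disjoint hdZ'.2] at h1
  have hcard : X.card = Z.card := (Finset.card_map _).symm
  rw [hcard]
  push_cast at h1
  linarith

end Contraction

/-! ### The canonical chain and its abstract properties -/

section Chain

variable {S : Type*} [Fintype S] [DecidableEq S] {p : Finset S → WithBot ℤ}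

/-- A chain `∅ = C 0 ⊆ C 1 ⊆ ⋯ ⊆ C q = S` of sets with finite values `c i = p (C i)`, and a
decreasing sequence `b` for which the box `b i - 1 ≤ x ≤ b i` on `C (i + 1) - C i` is compatible
with the base-polyhedron of the corresponding minor of `p`. -/
structure PeakChain (p : Finset S → WithBot ℤ) (q : ℕ) (C : ℕ → Finset S) (c b : ℕ → ℤ) :
    Prop where
  zero : C 0 = ∅
  last : C q = Finset.univ
  mono : Monotone C
  map_eq : ∀ i, p (C i) = c i
  anti : ∀ i, i + 1 < q → b (i + 1) < b i
  upper : ∀ i < q, ∀ (X : Finset S) (k : ℤ), X ⊆ C (i + 1) \ C i → p (X ∪ C i) = k →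
    k - c i ≤ b i * X.card
  lower : ∀ i < q, ∀ (X : Finset S) (k : ℤ), X ⊆ C (i + 1) \ C i → p (X ∪ C i) = k →
    k - (b i - 1) * X.card ≤ c (i + 1) - (b i - 1) * (C (i + 1) \ C i).card

lemma canonicalChain_succ (p : Finset S → WithBot ℤ) (i : ℕ) :
    canonicalChain p (i + 1) = canonicalChain p i ∪ peakAbove p (canonicalChain p i) := rfl

lemma canonicalPart_eq (p : Finset S → WithBot ℤ) (i : ℕ) :
    canonicalPart p i = peakAbove p (canonicalChain p i) := by
  rw [canonicalPart, canonicalChain_succ, Finset.union_sdiff_cancel_left]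
  exact (disjoint_peakAbove p _).symm

lemma monotone_canonicalChain (p : Finset S → WithBot ℤ) : Monotone (canonicalChain p) :=
  monotone_nat_of_le_succ fun _ => Finset.subset_union_left

lemma map_canonicalChain_ne_bot (hp : IsSupermodular p) (i : ℕ) : p (canonicalChain p i) ≠ ⊥ := by
  induction i with
  | zero =>
    rw [canonicalChain, hp.map_empty]
    exact WithBot.coe_ne_bot
  | succ i ih =>
    obtain ⟨c, hc⟩ := exists_coe_of_ne_bot ih
    exact map_union_peakAbove_ne_bot hp hc

lemma canonicalPart_nonempty (hp : IsSupermodular p) {i : ℕ}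
    (hi : canonicalChain p i ≠ Finset.univ) : (canonicalPart p i).Nonempty := by
  obtain ⟨c, hc⟩ := exists_coe_of_ne_bot (map_canonicalChain_ne_bot hp i)
  rw [canonicalPart_eq]
  exact peakAbove_nonempty hp hc hi

/-- Otherwise every part would be non-empty and the cardinalities would grow beyond |S|. -/
lemma exists_canonicalChain_eq_univ (hp : IsSupermodular p) :
    ∃ i, canonicalChain p i = Finset.univ := by
  by_contra! h
  have hs : StrictMono fun i => (canonicalChain p i).card := by
    refine strictMono_nat_of_lt_succ fun i => Finset.card_lt_card ?_
    refine (Finset.ssubset_iff_of_subset (monotone_canonicalChain p i.le_succ)).mpr ?_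
    obtain ⟨s, hs⟩ := canonicalPart_nonempty hp (h i)
    exact ⟨s, Finset.mem_sdiff.mp hs⟩
  have h1 := hs.id_le (Fintype.card S + 1)
  have h2 := Finset.card_le_univ (canonicalChain p (Fintype.card S + 1))
  simp only [id] at h1
  omega

lemma canonicalChain_canonicalLength (hp : IsSupermodular p) :
    canonicalChain p (canonicalLength p) = Finset.univ :=
  Nat.sInf_mem (s := {j | canonicalChain p j = Finset.univ}) (exists_canonicalChain_eq_univ hp)

lemma canonicalChain_ne_univ {i : ℕ} (hi : i < canonicalLength p) :
    canonicalChain p i ≠ Finset.univ :=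
  Nat.notMem_of_lt_sInf hi

lemma peakChain_canonical (hp : IsSupermodular p) :
    PeakChain p (canonicalLength p) (canonicalChain p)
      (fun i => (p (canonicalChain p i)).unbotD 0) (essentialValue p) := by
  have hc : ∀ i, p (canonicalChain p i) = (((p (canonicalChain p i)).unbotD 0 : ℤ) : WithBot ℤ) := by
    intro i
    obtain ⟨c, hc⟩ := exists_coe_of_ne_bot (map_canonicalChain_ne_bot hp i)
    rw [hc, WithBot.unbotD_coe]
  have hd : ∀ {i : ℕ} {X : Finset S}, X ⊆ canonicalChain p (i + 1) \ canonicalChain p i →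
      Disjoint X (canonicalChain p i) := fun hX =>
    Finset.disjoint_of_subset_left hX Finset.sdiff_disjoint
  exact
  { zero := rfl
    last := canonicalChain_canonicalLength hp
    mono := monotone_canonicalChain p
    map_eq := hc
    anti := fun i hi => beta_contract_union_peakAbove_lt hp (hc i) (canonicalChain_ne_univ hi)
    upper := fun i hi X k hX hk =>
      sub_le_beta_contract hp (hc i) (canonicalChain_ne_univ hi) (hd hX) hk
    lower := fun i hi X k hX hk => by
      have h := sub_le_peakAbove hp (hc i) (hd hX) hk (hc (i + 1))
      rw [← canonicalPart_eq] at h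
      exact h }

namespace PeakChain

variable {q : ℕ} {C : ℕ → Finset S} {c b : ℕ → ℤ}

lemma c_zero (h : PeakChain p q C c b) (hp : IsSupermodular p) : c 0 = 0 := by
  have := h.map_eq 0
  rw [h.zero, hp.map_empty] at this
  exact (WithBot.coe_injective this).symm

lemma map_univ (h : PeakChain p q C c b) : p Finset.univ = c q := by
  rw [← h.last, h.map_eq]

/-- The first member of the chain containing s has positive index because C 0 = ∅; its predecessor
is the required index. -/
lemma existsUnique_index (h : PeakChain p q C c b) (s : S) :
    ∃! i, i < q ∧ s ∈ C (i + 1) \ C i := by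
  have hex : ∃ j, s ∈ C j := ⟨q, by rw [h.last]; exact Finset.mem_univ s⟩
  obtain ⟨i, hi⟩ : ∃ i, Nat.find hex = i + 1 := by
    refine Nat.exists_eq_succ_of_ne_zero fun h0 => ?_
    have := Nat.find_spec hex
    rw [h0, h.zero] at this
    exact Finset.notMem_empty s this
  have h1 : s ∈ C (i + 1) := hi ▸ Nat.find_spec hex
  have h2 : s ∉ C i := Nat.find_min hex (by omega)
  have h3 : Nat.find hex ≤ q := Nat.find_min' hex (by rw [h.last]; exact Finset.mem_univ s)
  refine ⟨i, ⟨by omega, Finset.mem_sdiff.mpr ⟨h1, h2⟩⟩, ?_⟩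
  rintro j ⟨_, hj⟩
  rw [Finset.mem_sdiff] at hj
  rcases lt_trichotomy j i with hlt | heq | hlt
  · exact absurd (h.mono (by omega : j + 1 ≤ i) hj.1) h2
  · exact heq
  · exact absurd (h.mono (by omega : i + 1 ≤ j) h1) hj.2

lemma strictAntiOn (h : PeakChain p q C c b) : StrictAntiOn b (Set.Iio q) := by
  have key : ∀ d i, i + (d + 1) < q → b (i + (d + 1)) < b i := by
    intro d
    induction d with
    | zero => exact fun i hi => h.anti i hi
    | succ d ih =>
      intro i hi
      exact (h.anti (i + (d + 1)) hi).trans (ih i (by omega))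
  intro i _ j hj hij
  obtain ⟨d, rfl⟩ := Nat.exists_eq_add_of_lt hij
  exact key d i hj

end PeakChain

end Chain

end DecMin

namespace DecMin

/-! ### Integral points by the greedy algorithm -/

section BasePolyhedron

variable {S : Type*} [Fintype S] {p : Finset S → WithBot ℤ}

lemma le_sum_of_mem_basePolyhedron {x : S → ℝ} (hx : x ∈ basePolyhedron p) {Z : Finset S} {k : ℤ}
    (hk : (k : WithBot ℤ) ≤ p Z) : (k : ℝ) ≤ ∑ s ∈ Z, x s := by
  have h := hx.2 Z
  rw [map_cast_le_iff] at h
  obtain ⟨l, hl⟩ : ∃ l : ℤ, p Z = l := exists_coe_of_ne_bot fun hb => by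
    rw [hb] at hk
    exact WithBot.coe_ne_bot (le_bot_iff.mp hk)
  rw [hl, WithBot.coe_le_coe] at hk
  exact (Int.cast_le.mpr hk).trans (h l hl)

lemma sum_eq_of_mem_basePolyhedron {x : S → ℝ} (hx : x ∈ basePolyhedron p) {k : ℤ}
    (hk : p Finset.univ = k) : ∑ s, x s = k := by
  have h := hx.1
  rw [hk, WithBot.map_coe] at h
  exact WithBot.coe_injective h

variable [DecidableEq S]

/-- Elements are added one at a time, each receiving its marginal value; finiteness of p makes these
values integers. -/
lemma exists_integer_base (hp : IsSupermodular p) (hfin : ∀ X, p X ≠ ⊥) :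
    ∃ m : S → ℤ, m ∈ integralPoints (basePolyhedron p) := by
  choose v hv using fun X => exists_coe_of_ne_bot (hfin X)
  have hsup : ∀ X Y, v X + v Y ≤ v (X ∩ Y) + v (X ∪ Y) := by
    intro X Y
    have := hp.add_le X Y
    simp only [hv, ← WithBot.coe_add, WithBot.coe_le_coe] at this
    exact this
  have h0 : v ∅ = 0 := WithBot.coe_injective ((hv ∅).symm.trans hp.map_empty)
  have key : ∀ A : Finset S, ∃ m : S → ℤ, ∑ s ∈ A, m s = v A ∧ ∀ Z ⊆ A, v Z ≤ ∑ s ∈ Z, m s := by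
    intro A
    induction A using Finset.induction_on with
    | empty =>
      refine ⟨0, by simp [h0], fun Z hZ => ?_⟩
      rw [Finset.subset_empty.mp hZ]
      simp [h0]
    | insert a A ha ih =>
      obtain ⟨m, hm, hZ⟩ := ih
      have hupd : ∀ Z : Finset S, a ∉ Z →
          ∑ s ∈ Z, Function.update m a (v (insert a A) - v A) s = ∑ s ∈ Z, m s := by
        intro Z ha
        exact Finset.sum_congr rfl fun s hs => Function.update_of_ne (fun h => ha (by rwa [← h])) _ _
      refine ⟨Function.update m a (v (insert a A) - v A), ?_, fun Z hZA => ?_⟩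
      · rw [Finset.sum_insert ha, hupd A ha, hm, Function.update_self, sub_add_cancel]
      · by_cases haZ : a ∈ Z
        · rw [← Finset.insert_erase haZ, Finset.sum_insert (Finset.notMem_erase a Z),
            hupd _ (Finset.notMem_erase a Z), Function.update_self, Finset.insert_erase haZ]
          have hsub : Z.erase a ⊆ A := by
            rw [← Finset.subset_insert_iff]
            exact hZA
          -- Here Z ∩ A = Z - a and Z ∪ A = A + a, so the marginal value of a over A is at least
          -- that over Z - a.
          have h1 := hsup Z A
          have hi : Z ∩ A = Z.erase a := by
            ext s
            have := @hZA s
            rw [Finset.mem_insert] at this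
            simp only [Finset.mem_inter, Finset.mem_erase]
            refine ⟨fun h => ⟨fun h2 => ha (h2 ▸ h.2), h.1⟩, fun h => ⟨h.2, ?_⟩⟩
            exact (this h.2).resolve_left h.1
          have hu : Z ∪ A = insert a A := by
            refine Finset.Subset.antisymm (Finset.union_subset hZA (Finset.subset_insert _ _)) ?_
            exact Finset.insert_subset (Finset.mem_union_left _ haZ) Finset.subset_union_right
          rw [hi, hu] at h1
          have := hZ _ hsub
          linarith
        · rw [hupd Z haZ]
          exact hZ Z fun s hs =>
            (Finset.mem_insert.mp (hZA hs)).resolve_left fun h => haZ (by rwa [← h])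
  obtain ⟨m, hm, hZ⟩ := key Finset.univ
  refine ⟨m, (mem_basePolyhedron_iff hp.map_univ_ne_bot).mpr ⟨fun k hk => ?_, fun Z k hk => ?_⟩⟩
  · rw [hv] at hk
    rw [← WithBot.coe_injective hk]
    exact_mod_cast hm
  · rw [hv] at hk
    rw [← WithBot.coe_injective hk]
    exact_mod_cast hZ Z (Finset.subset_univ Z)

end BasePolyhedron

/-! ### Intersection of a base-polyhedron with a box -/

section Box

variable {S : Type*} [Fintype S] [DecidableEq S] {p : Finset S → WithBot ℤ} {f g : S → ℤ}

/-- `g (Y - X) - f (X - Y)`. -/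
def boxCost (f g : S → ℤ) (X Y : Finset S) : ℤ :=
  ∑ s, if s ∈ Y then (if s ∈ X then 0 else g s) else (if s ∈ X then -f s else 0)

/-- The set-function `X ↦ max {p Y - g (Y - X) + f (X - Y) : Y ⊆ S}`, defining the intersection of
`B'(p)` with the box `f ≤ x ≤ g`. -/
def boxFun (p : Finset S → WithBot ℤ) (f g : S → ℤ) (X : Finset S) : WithBot ℤ :=
  Finset.univ.sup fun Y => p Y + ((-boxCost f g X Y : ℤ) : WithBot ℤ)

lemma coe_le_boxFun_iff {X : Finset S} {a : ℤ} :
    (a : WithBot ℤ) ≤ boxFun p f g X ↔ ∃ (Y : Finset S) (k : ℤ), p Y = k ∧ a ≤ k - boxCost f g X Y := by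
  rw [boxFun, Finset.le_sup_iff (WithBot.bot_lt_coe a)]
  refine exists_congr fun Y => ?_
  rw [and_iff_right (Finset.mem_univ _)]
  cases p Y with
  | bot => simp
  | coe k =>
    rw [← WithBot.coe_add, WithBot.coe_le_coe]
    simp [sub_eq_add_neg]

/-- Checked element by element. Strictness can occur only when s lies in exactly one of X - Y, Y - X
and the opposite holds for X', Y'; there the right side is g s - f s and the left side 0. -/
lemma boxCost_inter_add_union_le (hfg : ∀ s, f s ≤ g s) (X X' Y Y' : Finset S) :
    boxCost f g (X ∩ X') (Y ∩ Y') + boxCost f g (X ∪ X') (Y ∪ Y') ≤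
      boxCost f g X Y + boxCost f g X' Y' := by
  simp only [boxCost, ← Finset.sum_add_distrib]
  refine Finset.sum_le_sum fun s _ => ?_
  have := hfg s
  by_cases h1 : s ∈ X <;> by_cases h2 : s ∈ X' <;> by_cases h3 : s ∈ Y <;> by_cases h4 : s ∈ Y' <;>
    simp [h1, h2, h3, h4, this]

lemma boxCost_self (f g : S → ℤ) (X : Finset S) : boxCost f g X X = 0 :=
  Finset.sum_eq_zero fun s _ => by by_cases h : s ∈ X <;> simp [h]

lemma boxCost_empty_left (f g : S → ℤ) (Y : Finset S) : boxCost f g ∅ Y = ∑ s ∈ Y, g s := by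
  simp [boxCost]

lemma boxCost_empty_right (f g : S → ℤ) (X : Finset S) : boxCost f g X ∅ = -∑ s ∈ X, f s := by
  simp [boxCost, Finset.sum_ite_mem]

lemma boxCost_univ_left (f g : S → ℤ) (Y : Finset S) :
    boxCost f g Finset.univ Y = -∑ s ∈ Yᶜ, f s := by
  simp only [boxCost, Finset.mem_univ, if_true]
  rw [← Finset.sum_neg_distrib, Finset.sum_ite, Finset.sum_const_zero, zero_add]
  congr 1
  ext s
  simp

lemma boxCost_univ_right (f g : S → ℤ) (X : Finset S) :
    boxCost f g X Finset.univ = ∑ s ∈ Xᶜ, g s := by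
  simp only [boxCost, Finset.mem_univ, if_true]
  rw [Finset.sum_ite, Finset.sum_const_zero, zero_add]
  congr 1
  ext s
  simp

/-- The choice Y = ∅ bounds the maximum below by f(X), even where p is -∞; this makes the greedy
algorithm applicable. -/
lemma boxFun_ne_bot (hp : IsSupermodular p) (X : Finset S) : boxFun p f g X ≠ ⊥ := by
  intro hb
  have h : ((∑ s ∈ X, f s : ℤ) : WithBot ℤ) ≤ boxFun p f g X :=
    coe_le_boxFun_iff.mpr ⟨∅, 0, hp.map_empty, by rw [boxCost_empty_right]; simp⟩
  rw [hb] at h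
  exact WithBot.coe_ne_bot (le_bot_iff.mp h)

lemma eq_coe_of_forall_coe_le_iff {w : WithBot ℤ} {c : ℤ}
    (h : ∀ a : ℤ, (a : WithBot ℤ) ≤ w ↔ a ≤ c) : w = c := by
  cases w with
  | bot => exact absurd ((h c).mpr le_rfl) (by simp)
  | coe k =>
    have h1 := (h k).mp le_rfl
    have h2 := WithBot.coe_le_coe.mp ((h c).mpr le_rfl)
    rw [le_antisymm h1 h2]

lemma boxFun_univ {c : ℤ} (hc : p Finset.univ = c)
    (hl : ∀ (Y : Finset S) (k : ℤ), p Y = k → k + ∑ s ∈ Yᶜ, f s ≤ c) :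
    boxFun p f g Finset.univ = c := by
  refine eq_coe_of_forall_coe_le_iff fun a => coe_le_boxFun_iff.trans ⟨?_, fun h => ?_⟩
  · rintro ⟨Y, k, hk, ha⟩
    rw [boxCost_univ_left] at ha
    have := hl Y k hk
    linarith
  · exact ⟨Finset.univ, c, hc, by rwa [boxCost_self, sub_zero]⟩

lemma boxFun_empty (hp : IsSupermodular p)
    (hu : ∀ (Y : Finset S) (k : ℤ), p Y = k → k ≤ ∑ s ∈ Y, g s) : boxFun p f g ∅ = 0 := by
  refine eq_coe_of_forall_coe_le_iff (c := 0) fun a => coe_le_boxFun_iff.trans ⟨?_, fun h => ?_⟩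
  · rintro ⟨Y, k, hk, ha⟩
    rw [boxCost_empty_left] at ha
    have := hu Y k hk
    linarith
  · exact ⟨∅, 0, hp.map_empty, by rwa [boxCost_self, sub_zero]⟩

/-- If Y and Y' are optimal for X and X', then Y ∩ Y' and Y ∪ Y' are candidates for X ∩ X' and X ∪
X'. -/
lemma isSupermodular_boxFun (hp : IsSupermodular p) (hfg : ∀ s, f s ≤ g s)
    (hu : ∀ (Y : Finset S) (k : ℤ), p Y = k → k ≤ ∑ s ∈ Y, g s) :
    IsSupermodular (boxFun p f g) where
  map_empty := boxFun_empty hp hu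
  map_univ_ne_bot := boxFun_ne_bot hp _
  add_le X X' := by
    obtain ⟨a, ha⟩ := exists_coe_of_ne_bot (boxFun_ne_bot (f := f) (g := g) hp X)
    obtain ⟨a', ha'⟩ := exists_coe_of_ne_bot (boxFun_ne_bot (f := f) (g := g) hp X')
    obtain ⟨Y, k, hk, hak⟩ := coe_le_boxFun_iff.mp ha.ge
    obtain ⟨Y', k', hk', hak'⟩ := coe_le_boxFun_iff.mp ha'.ge
    obtain ⟨l, l', hl, hl', hkl⟩ := hp.exists_coe hk hk'
    have h1 := coe_le_boxFun_iff.mpr ⟨Y ∩ Y', l, hl, le_refl (l - boxCost f g (X ∩ X') (Y ∩ Y'))⟩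
    have h2 := coe_le_boxFun_iff.mpr ⟨Y ∪ Y', l', hl', le_refl (l' - boxCost f g (X ∪ X') (Y ∪ Y'))⟩
    have h3 := boxCost_inter_add_union_le hfg X X' Y Y'
    refine le_trans ?_ (add_le_add h1 h2)
    rw [ha, ha', ← WithBot.coe_add, ← WithBot.coe_add, WithBot.coe_le_coe]
    linarith

lemma sum_sub_boxCost_le {x : S → ℝ} (hx : ∀ s, (f s : ℝ) ≤ x s ∧ x s ≤ g s) (X Y : Finset S) :
    ∑ s ∈ Y, x s - boxCost f g X Y ≤ ∑ s ∈ X, x s := by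
  have hX : ∀ Z : Finset S, ∑ s ∈ Z, x s = ∑ s, if s ∈ Z then x s else 0 := fun Z => by
    rw [Finset.sum_ite_mem, Finset.univ_inter]
  rw [hX X, hX Y, boxCost, Int.cast_sum, ← Finset.sum_sub_distrib]
  refine Finset.sum_le_sum fun s _ => ?_
  by_cases h1 : s ∈ X <;> by_cases h2 : s ∈ Y <;> simp [h1, h2, hx s]

lemma basePolyhedron_boxFun (hp : IsSupermodular p) {c : ℤ} (hc : p Finset.univ = c)
    (hl : ∀ (Y : Finset S) (k : ℤ), p Y = k → k + ∑ s ∈ Yᶜ, f s ≤ c) :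
    basePolyhedron (boxFun p f g) =
      {x | x ∈ basePolyhedron p ∧ ∀ s, (f s : ℝ) ≤ x s ∧ x s ≤ g s} := by
  have hbu := boxFun_univ (g := g) hc hl
  ext x
  constructor
  · intro hx
    have hsum := sum_eq_of_mem_basePolyhedron hx hbu
    have hle : ∀ (X Y : Finset S) (k : ℤ), p Y = k →
        (k : ℝ) - boxCost f g X Y ≤ ∑ s ∈ X, x s := fun X Y k hk => by
      have := le_sum_of_mem_basePolyhedron hx (coe_le_boxFun_iff.mpr ⟨Y, k, hk, le_rfl⟩) (Z := X)
      exact_mod_cast this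
    refine ⟨(mem_basePolyhedron_iff hp.map_univ_ne_bot).mpr ⟨fun k hk => ?_, fun Z k hk => ?_⟩,
      fun s => ⟨?_, ?_⟩⟩
    · rw [hsum, WithBot.coe_injective (hc.symm.trans hk)]
    -- Suitable pairs (X, Y) recover all constraints: (Z, Z) those of p, ({s}, ∅) the lower bound,
    -- and (S - s, S) the upper bound.
    · simpa [boxCost_self] using hle Z Z k hk
    · simpa [boxCost_empty_right] using hle {s} ∅ 0 hp.map_empty
    · have h1 := hle {s}ᶜ Finset.univ c hc
      rw [boxCost_univ_right, compl_compl, Finset.sum_singleton, ← hsum,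
        ← Finset.sum_add_sum_compl {s}, Finset.sum_singleton] at h1
      linarith
  · rintro ⟨hx, hb⟩
    refine (mem_basePolyhedron_iff (boxFun_ne_bot hp _)).mpr ⟨fun k hk => ?_, fun Z k hk => ?_⟩
    · rw [sum_eq_of_mem_basePolyhedron hx hc, WithBot.coe_injective (hbu.symm.trans hk)]
    · obtain ⟨Y, l, hY, hkl⟩ := coe_le_boxFun_iff.mp hk.ge
      have h1 := sum_sub_boxCost_le hb Z Y
      have h2 := le_sum_of_mem_basePolyhedron hx hY.ge
      have h3 : (k : ℝ) ≤ l - boxCost f g Z Y := by exact_mod_cast hkl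
      linarith

end Box

/-! ### The face cut out by the chain, and its intersection with the box -/

section Face

variable {S : Type*} [Fintype S] [DecidableEq S] {p : Finset S → WithBot ℤ} {q : ℕ}
  {C : ℕ → Finset S} {c b : ℕ → ℤ}

/-- The set-function `X ↦ ∑ i < q, p ((X ∩ C (i + 1)) ∪ C i) - c i`, defining the face of `B'(p)`
on which the members of the chain `C` are tight. -/
def faceFun (p : Finset S → WithBot ℤ) (q : ℕ) (C : ℕ → Finset S) (c : ℕ → ℤ) (X : Finset S) :
    WithBot ℤ :=
  ∑ i ∈ Finset.range q, (p (X ∩ C (i + 1) ∪ C i) + ((-c i : ℤ) : WithBot ℤ))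

namespace PeakChain

lemma inter_union_eq (h : PeakChain p q C c b) (X : Finset S) (i : ℕ) :
    X ∩ C (i + 1) ∪ C i = X ∩ (C (i + 1) \ C i) ∪ C i := by
  ext s
  have := @h.mono i (i + 1) i.le_succ s
  simp only [Finset.mem_union, Finset.mem_inter, Finset.mem_sdiff]
  tauto

lemma sum_inter_sdiff (h : PeakChain p q C c b) {M : Type*} [AddCommMonoid M] (f : S → M)
    (Z : Finset S) :
    ∑ i ∈ Finset.range q, ∑ s ∈ Z ∩ (C (i + 1) \ C i), f s = ∑ s ∈ Z, f s := by
  rw [← Finset.sum_biUnion]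
  · congr 1
    ext s
    obtain ⟨i, hi, _⟩ := h.existsUnique_index s
    simp only [Finset.mem_biUnion, Finset.mem_range, Finset.mem_inter]
    exact ⟨fun ⟨_, _, hs, _⟩ => hs, fun hs => ⟨i, hi.1, hs, hi.2⟩⟩
  · intro i hi j hj hij
    refine Finset.disjoint_left.mpr fun s hsi hsj => hij ?_
    simp only [Finset.coe_range, Set.mem_Iio] at hi hj
    exact (h.existsUnique_index s).unique ⟨hi, (Finset.mem_inter.mp hsi).2⟩
      ⟨hj, (Finset.mem_inter.mp hsj).2⟩

/-- Upper bounds for the separate minors add up. The bound φ is left free so as to serve both for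
vectors of the face and for the two box conditions. -/
lemma faceFun_le_of_forall (h : PeakChain p q C c b) {φ : ℕ → Finset S → ℝ}
    (hφ : ∀ i < q, ∀ (X : Finset S) (k : ℤ), X ⊆ C (i + 1) \ C i → p (X ∪ C i) = k →
      (k : ℝ) - c i ≤ φ i X) {X : Finset S} {k : ℤ} (hk : faceFun p q C c X = k) :
    (k : ℝ) ≤ ∑ i ∈ Finset.range q, φ i (X ∩ (C (i + 1) \ C i)) := by
  obtain ⟨κ, hκ, rfl⟩ := exists_of_sum_eq_coe _ _ hk
  rw [Int.cast_sum]
  refine Finset.sum_le_sum fun i hi => ?_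
  have h1 := hκ i hi
  obtain ⟨l, hl⟩ : ∃ l : ℤ, p (X ∩ C (i + 1) ∪ C i) = l := exists_coe_of_ne_bot fun hb => by
    rw [hb, WithBot.bot_add] at h1
    exact WithBot.bot_ne_coe h1
  rw [hl, ← WithBot.coe_add, WithBot.coe_inj] at h1
  rw [h.inter_union_eq] at hl
  have h2 := hφ i (Finset.mem_range.mp hi) _ l Finset.inter_subset_right hl
  rw [← h1]
  push_cast
  linarith

/-- Supermodularity for X ∩ C (j + 1) and C j, summed along the chain. -/
lemma map_le_faceFun (h : PeakChain p q C c b) (hp : IsSupermodular p) (X : Finset S) :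
    p X ≤ faceFun p q C c X := by
  have key : ∀ j, p (X ∩ C j) ≤
      ∑ i ∈ Finset.range j, (p (X ∩ C (i + 1) ∪ C i) + ((-c i : ℤ) : WithBot ℤ)) := by
    intro j
    induction j with
    | zero => simp [h.zero, hp.map_empty]
    | succ j ih =>
      rw [Finset.sum_range_succ]
      have h1 := hp.add_le (X ∩ C (j + 1)) (C j)
      have h2 : X ∩ C (j + 1) ∩ C j = X ∩ C j := by
        rw [Finset.inter_assoc, Finset.inter_eq_right.mpr (h.mono j.le_succ)]
      rw [h2, h.map_eq j] at h1
      calc p (X ∩ C (j + 1)) = p (X ∩ C (j + 1)) + c j + ((-c j : ℤ) : WithBot ℤ) := by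
            rw [add_assoc, ← WithBot.coe_add, add_neg_cancel, WithBot.coe_zero, add_zero]
        _ ≤ p (X ∩ C j) + p (X ∩ C (j + 1) ∪ C j) + ((-c j : ℤ) : WithBot ℤ) :=
            add_le_add h1 le_rfl
        _ ≤ _ := by rw [add_assoc]; exact add_le_add ih le_rfl
  have := key q
  rwa [h.last, Finset.inter_univ] at this

/-- This value forces x(C j) ≤ c j, the half of tightness that p itself does not give. -/
lemma faceFun_compl (h : PeakChain p q C c b) {j : ℕ} (hj : j ≤ q) :
    faceFun p q C c (C j)ᶜ = ((c q - c j : ℤ) : WithBot ℤ) := by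
  -- Terms with i < j vanish and the others are c (i + 1) - c i; the maxima cover both cases in one
  -- telescoping form.
  have hterm : ∀ i, p ((C j)ᶜ ∩ C (i + 1) ∪ C i) + ((-c i : ℤ) : WithBot ℤ) =
      ((c (max (i + 1) j) - c (max i j) : ℤ) : WithBot ℤ) := by
    intro i
    rcases lt_or_ge i j with hij | hij
    · have he : (C j)ᶜ ∩ C (i + 1) ∪ C i = C i := by
        rw [Finset.union_eq_right]
        intro s hs
        rw [Finset.mem_inter, Finset.mem_compl] at hs
        exact absurd (h.mono hij hs.2) hs.1
      rw [he, h.map_eq, ← WithBot.coe_add, max_eq_right (by omega), max_eq_right (by omega)]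
      simp
    · have he : (C j)ᶜ ∩ C (i + 1) ∪ C i = C (i + 1) := by
        ext s
        have h1 := @h.mono i (i + 1) i.le_succ s
        have h2 := @h.mono j i hij s
        simp only [Finset.mem_union, Finset.mem_inter, Finset.mem_compl]
        tauto
      rw [he, h.map_eq, ← WithBot.coe_add, max_eq_left (by omega), max_eq_left (by omega),
        sub_eq_add_neg]
  rw [faceFun, Finset.sum_congr rfl fun i _ => hterm i, ← WithBot.coe_sum,
    Finset.sum_range_sub (fun i => c (max i j)), max_eq_left hj, max_eq_right (Nat.zero_le j)]

lemma faceFun_univ (h : PeakChain p q C c b) (hp : IsSupermodular p) :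
    faceFun p q C c Finset.univ = c q := by
  have := h.faceFun_compl (Nat.zero_le q)
  rwa [h.zero, Finset.compl_empty, h.c_zero hp, sub_zero] at this

lemma isSupermodular_faceFun (h : PeakChain p q C c b) (hp : IsSupermodular p) :
    IsSupermodular (faceFun p q C c) where
  map_empty := by
    have := h.faceFun_compl le_rfl
    rwa [h.last, Finset.compl_univ, sub_self] at this
  map_univ_ne_bot := by
    rw [h.faceFun_univ hp]
    exact WithBot.coe_ne_bot
  add_le X Y := by
    rw [faceFun, faceFun, faceFun, faceFun, ← Finset.sum_add_distrib, ← Finset.sum_add_distrib]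
    refine Finset.sum_le_sum fun i _ => ?_
    have hI : (X ∩ Y) ∩ C (i + 1) ∪ C i = (X ∩ C (i + 1) ∪ C i) ∩ (Y ∩ C (i + 1) ∪ C i) := by
      rw [← Finset.inter_union_distrib_right, ← Finset.inter_inter_distrib_right]
    have hU : (X ∪ Y) ∩ C (i + 1) ∪ C i = (X ∩ C (i + 1) ∪ C i) ∪ (Y ∩ C (i + 1) ∪ C i) := by
      rw [← Finset.union_union_distrib_right, ← Finset.union_inter_distrib_right]
    rw [hI, hU]
    exact (add_add_add_comm _ _ _ _).trans_le
      ((add_le_add (hp.add_le _ _) le_rfl).trans_eq (add_add_add_comm _ _ _ _))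

lemma mem_basePolyhedron_faceFun_of_forall (h : PeakChain p q C c b) (hp : IsSupermodular p)
    {x : S → ℝ} (hsum : ∑ s, x s = c q)
    (hx : ∀ i < q, ∀ (X : Finset S) (k : ℤ), X ⊆ C (i + 1) \ C i → p (X ∪ C i) = k →
      (k : ℝ) - c i ≤ ∑ s ∈ X, x s) : x ∈ basePolyhedron (faceFun p q C c) := by
  have hu := h.faceFun_univ hp
  refine (mem_basePolyhedron_iff (by rw [hu]; exact WithBot.coe_ne_bot)).mpr
    ⟨fun k hk => ?_, fun Z k hk => ?_⟩
  · rw [hsum, WithBot.coe_injective (hu.symm.trans hk)]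
  · have := h.faceFun_le_of_forall hx hk
    rwa [h.sum_inter_sdiff] at this

lemma basePolyhedron_faceFun (h : PeakChain p q C c b) (hp : IsSupermodular p) :
    basePolyhedron (faceFun p q C c) =
      {x | x ∈ basePolyhedron p ∧ ∀ i ≤ q, ∑ s ∈ C i, x s = c i} := by
  have hu := h.faceFun_univ hp
  ext x
  constructor
  · intro hx
    have hsum := sum_eq_of_mem_basePolyhedron hx hu
    have hB : ∀ (Z : Finset S) (k : ℤ), p Z = k → (k : ℝ) ≤ ∑ s ∈ Z, x s := fun Z k hk =>
      le_sum_of_mem_basePolyhedron hx (hk.ge.trans (h.map_le_faceFun hp Z))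
    refine ⟨(mem_basePolyhedron_iff hp.map_univ_ne_bot).mpr ⟨fun k hk => ?_, hB⟩, fun i hi => ?_⟩
    · rw [hsum, WithBot.coe_injective (h.map_univ.symm.trans hk)]
    · refine le_antisymm ?_ (hB _ _ (h.map_eq i))
      have h1 := le_sum_of_mem_basePolyhedron hx (h.faceFun_compl hi).ge
      push_cast at h1
      rw [← hsum, ← Finset.sum_add_sum_compl (C i)] at h1
      linarith
  · rintro ⟨hx, ht⟩
    refine h.mem_basePolyhedron_faceFun_of_forall hp
      (sum_eq_of_mem_basePolyhedron hx h.map_univ) fun i hi X k hX hk => ?_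
    have h1 := le_sum_of_mem_basePolyhedron hx hk.ge
    rw [Finset.sum_union (Finset.disjoint_of_subset_left hX Finset.sdiff_disjoint),
      ht i hi.le] at h1
    linarith

/-- The index `i` with `s ∈ C (i + 1) - C i`. -/
noncomputable def index (h : PeakChain p q C c b) (s : S) : ℕ :=
  (h.existsUnique_index s).choose

lemma index_lt (h : PeakChain p q C c b) (s : S) : h.index s < q :=
  (h.existsUnique_index s).choose_spec.1.1

lemma mem_index (h : PeakChain p q C c b) (s : S) : s ∈ C (h.index s + 1) \ C (h.index s) :=
  (h.existsUnique_index s).choose_spec.1.2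

lemma index_eq (h : PeakChain p q C c b) {s : S} {i : ℕ} (hi : i < q)
    (hs : s ∈ C (i + 1) \ C i) : h.index s = i :=
  ((h.existsUnique_index s).unique ⟨hi, hs⟩ ⟨h.index_lt s, h.mem_index s⟩).symm

lemma sum_index_eq (h : PeakChain p q C c b) {M : Type*} [AddCommMonoid M] (F : S → ℕ → M)
    {i : ℕ} (hi : i < q) {X : Finset S} (hX : X ⊆ C (i + 1) \ C i) :
    ∑ s ∈ X, F s (h.index s) = ∑ s ∈ X, F s i :=
  Finset.sum_congr rfl fun s hs => by rw [h.index_eq hi (hX hs)]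

/-- First feasibility condition for the box, from `upper`: it keeps the value of the truncated
function at ∅ equal to 0. -/
lemma faceFun_le_sum (h : PeakChain p q C c b) {Y : Finset S} {k : ℤ}
    (hk : faceFun p q C c Y = k) : k ≤ ∑ s ∈ Y, b (h.index s) := by
  have h1 := h.faceFun_le_of_forall (φ := fun i X => ∑ s ∈ X, ((b (h.index s) : ℤ) : ℝ))
    (fun i hi X l hX hl => by
      rw [h.sum_index_eq (fun _ i => ((b i : ℤ) : ℝ)) hi hX, Finset.sum_const, nsmul_eq_mul]
      have := h.upper i hi X l hX hl
      rw [mul_comm]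
      exact_mod_cast this) hk
  rw [h.sum_inter_sdiff] at h1
  exact_mod_cast h1

/-- Second feasibility condition, from `lower`: it keeps the total value equal to p(S). -/
lemma faceFun_add_sum_compl_le (h : PeakChain p q C c b) (hp : IsSupermodular p) {Y : Finset S}
    {k : ℤ} (hk : faceFun p q C c Y = k) : k + ∑ s ∈ Yᶜ, (b (h.index s) - 1) ≤ c q := by
  have hpart : ∀ i < q, ∀ X ⊆ C (i + 1) \ C i,
      ∑ s ∈ X, ((b (h.index s) - 1 : ℤ) : ℝ) = X.card * (b i - 1) := fun i hi X hX => by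
    rw [h.sum_index_eq (fun _ i => ((b i - 1 : ℤ) : ℝ)) hi hX, Finset.sum_const, nsmul_eq_mul]
    push_cast
    rfl
  have h1 := h.faceFun_le_of_forall
    (φ := fun i X => ((c (i + 1) : ℝ) - c i) -
      ∑ s ∈ Finset.univ ∩ (C (i + 1) \ C i), ((b (h.index s) - 1 : ℤ) : ℝ) +
      ∑ s ∈ X, ((b (h.index s) - 1 : ℤ) : ℝ))
    (fun i hi X l hX hl => by
      have h2 := h.lower i hi X l hX hl
      have h3 : (l : ℝ) - (b i - 1) * X.card ≤
          c (i + 1) - (b i - 1) * (C (i + 1) \ C i).card := by exact_mod_cast h2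
      rw [hpart i hi X hX, Finset.univ_inter, hpart i hi _ subset_rfl]
      linarith) hk
  rw [Finset.sum_add_distrib, Finset.sum_sub_distrib, Finset.sum_range_sub (fun i => (c i : ℝ)),
    h.sum_inter_sdiff, h.sum_inter_sdiff, ← Finset.sum_add_sum_compl Y, h.c_zero hp] at h1
  have h2 : (k : ℝ) + ∑ s ∈ Yᶜ, ((b (h.index s) - 1 : ℤ) : ℝ) ≤ c q := by
    push_cast at h1 ⊢
    linarith
  exact_mod_cast h2

/-- The set-function defining the face of `B'(p)` given by the chain, intersected with the box. -/
noncomputable def bulletFun (h : PeakChain p q C c b) : Finset S → WithBot ℤ :=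
  boxFun (faceFun p q C c) (fun s => b (h.index s) - 1) (fun s => b (h.index s))

lemma isSupermodular_bulletFun (h : PeakChain p q C c b) (hp : IsSupermodular p) :
    IsSupermodular h.bulletFun :=
  isSupermodular_boxFun (h.isSupermodular_faceFun hp) (fun s => by omega)
    fun _ _ hk => h.faceFun_le_sum hk

lemma bulletFun_ne_bot (h : PeakChain p q C c b) (hp : IsSupermodular p) (X : Finset S) :
    h.bulletFun X ≠ ⊥ :=
  boxFun_ne_bot (h.isSupermodular_faceFun hp) X

lemma basePolyhedron_bulletFun (h : PeakChain p q C c b) (hp : IsSupermodular p) :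
    basePolyhedron h.bulletFun =
      {x | (x ∈ basePolyhedron p ∧ ∀ i ≤ q, ∑ s ∈ C i, x s = c i) ∧
        ∀ i < q, ∀ s ∈ C (i + 1) \ C i, (b i : ℝ) - 1 ≤ x s ∧ x s ≤ b i} := by
  rw [bulletFun, basePolyhedron_boxFun (h.isSupermodular_faceFun hp) (h.faceFun_univ hp)
    fun _ _ hk => h.faceFun_add_sum_compl_le hp hk, h.basePolyhedron_faceFun hp]
  ext x
  refine and_congr_right fun _ => ⟨fun hx i hi s hs => ?_, fun hx s => ?_⟩
  · have := hx s
    rw [h.index_eq hi hs] at this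
    exact_mod_cast this
  · have := hx _ (h.index_lt s) s (h.mem_index s)
    exact_mod_cast this

end PeakChain

end Face

end DecMin

namespace DecMin

/-! ### Decreasing order as the order of a rapidly growing convex weight -/

section RapidWeight

/-- At the first difference a < b, fewer than K terms of the smaller list remain, each at most K ^
a, so their sum is below K ^ (a + 1) ≤ K ^ b. -/
lemma sum_zpow_lt_of_lex {K : ℚ} (hK : 1 < K) {l₁ l₂ : List ℤ}
    (h : List.Lex (fun a b : ℤ => a < b) l₁ l₂) (hs : l₁.Pairwise (fun a b => b ≤ a))
    (hlen : (l₁.length : ℚ) < K) :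
    (l₁.map (fun t => K ^ t)).sum < (l₂.map (fun t => K ^ t)).sum := by
  have hK0 : 0 < K := zero_lt_one.trans hK
  have hnn : ∀ l : List ℤ, 0 ≤ (l.map (fun t => K ^ t)).sum := fun l =>
    List.sum_nonneg fun x hx => by
      obtain ⟨t, _, rfl⟩ := List.mem_map.mp hx
      exact (zpow_pos hK0 t).le
  induction h with
  | nil =>
    rename_i a l
    simp only [List.map_nil, List.sum_nil, List.map_cons, List.sum_cons]
    have := zpow_pos hK0 a
    have := hnn l
    linarith
  | cons _ ih =>
    simp only [List.map_cons, List.sum_cons]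
    rw [List.pairwise_cons] at hs
    have := ih hs.2 (by rw [List.length_cons] at hlen; push_cast at hlen; linarith)
    linarith
  | rel hab =>
    rename_i a l b l'
    have h1 : ((a :: l).map (fun t => K ^ t)).sum ≤ (a :: l).length * K ^ a := by
      have := List.sum_le_card_nsmul ((a :: l).map (fun t => K ^ t)) (K ^ a) fun x hx => by
        obtain ⟨t, ht, rfl⟩ := List.mem_map.mp hx
        refine zpow_le_zpow_right₀ hK.le ?_
        rcases List.mem_cons.mp ht with rfl | ht
        · exact le_rfl
        · exact (List.pairwise_cons.mp hs).1 t ht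
      rwa [List.length_map, nsmul_eq_mul] at this
    calc _ ≤ _ := h1
      _ < K * K ^ a := by gcongr
      _ = K ^ (a + 1) := by rw [zpow_add_one₀ hK0.ne', mul_comm]
      _ ≤ K ^ b := zpow_le_zpow_right₀ hK.le hab
      _ ≤ _ := by
        rw [List.map_cons, List.sum_cons]
        exact le_add_of_nonneg_right (hnn l')

/-- The left side is the chord of K ^ u through u = 0 and u = 1. For u ≥ 0 this is Bernoulli's
inequality; for u < 0 the chord is not positive, as K ≥ 2. -/
lemma one_add_mul_le_zpow {K : ℚ} (hK : 2 ≤ K) (u : ℤ) : 1 + (K - 1) * u ≤ K ^ u := by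
  rcases le_or_gt 0 u with hu | hu
  · lift u to ℕ using hu
    have := one_add_mul_le_pow (a := K - 1) (by linarith) u
    rw [add_sub_cancel, mul_comm] at this
    exact_mod_cast this
  · have h1 := zpow_pos (by linarith : 0 < K) u
    have h2 : (u : ℚ) ≤ -1 := by exact_mod_cast Int.le_sub_one_of_lt hu
    nlinarith

lemma one_add_mul_eq_zpow_iff {K : ℚ} (hK : 2 ≤ K) (u : ℤ) :
    1 + (K - 1) * u = K ^ u ↔ u = 0 ∨ u = 1 := by
  constructor
  · intro h
    rcases lt_or_ge u 0 with hu | hu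
    · have h1 := zpow_pos (by linarith : 0 < K) u
      have h2 : (u : ℚ) ≤ -1 := by exact_mod_cast Int.le_sub_one_of_lt hu
      nlinarith
    · by_contra hn
      -- For u ≥ 2, multiplying the bound at u - 1 by K beats the chord at u by (K - 1)²(u - 1) > 0.
      have h1 := one_add_mul_le_zpow hK (u - 1)
      have h2 : K ^ u = K * K ^ (u - 1) := by
        rw [← zpow_one_add₀ (by linarith)]
        congr 1
        ring
      have h3 : (1 : ℚ) ≤ ((u - 1 : ℤ) : ℚ) := by
        have : 1 ≤ u - 1 := by omega
        exact_mod_cast this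
      have h4 : K * (1 + (K - 1) * ((u - 1 : ℤ) : ℚ)) ≤ K * K ^ (u - 1) := by gcongr
      rw [← h2, ← h] at h4
      push_cast at h3 h4
      have h5 : 0 < (K - 1) * (K - 1) * (u - 1 : ℚ) := by
        have : 0 < K - 1 := by linarith
        have : (0 : ℚ) < u - 1 := by linarith
        positivity
      nlinarith
  · rintro (rfl | rfl) <;> simp

/-- `∑ K ^ x(s)` with `K = |S| + 1`. Its order on integer vectors is that of `DecLE`. -/
def rapidWeight {S : Type*} [Fintype S] (x : S → ℤ) : ℚ :=
  ∑ s, ((Fintype.card S : ℚ) + 1) ^ (x s)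

variable {S : Type*} [Fintype S]

lemma rapidWeight_eq_sum_sortDown (x : S → ℤ) :
    rapidWeight x = ((sortDown x).map (fun t => ((Fintype.card S : ℚ) + 1) ^ t)).sum := by
  rw [sortDown, ← Multiset.sum_coe, ← Multiset.map_coe, Multiset.sort_eq, Multiset.map_map]
  rfl

lemma rapidWeight_lt_of_decLT [Nonempty S] {x y : S → ℤ} (h : DecLT x y) :
    rapidWeight x < rapidWeight y := by
  rw [rapidWeight_eq_sum_sortDown, rapidWeight_eq_sum_sortDown]
  have hpos : 0 < (Fintype.card S : ℚ) := by exact_mod_cast Fintype.card_pos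
  refine sum_zpow_lt_of_lex (by linarith) h (Multiset.pairwise_sort _ _) ?_
  rw [sortDown, Multiset.length_sort, Multiset.card_map]
  change ((Fintype.card S : ℕ) : ℚ) < _
  linarith

lemma decLE_iff_rapidWeight_le [Nonempty S] {x y : S → ℤ} :
    DecLE x y ↔ rapidWeight x ≤ rapidWeight y := by
  constructor
  · rintro (h | h)
    · exact (rapidWeight_lt_of_decLT h).le
    · rw [rapidWeight_eq_sum_sortDown, rapidWeight_eq_sum_sortDown, h]
  · intro h
    rcases lt_trichotomy (sortDown x) (sortDown y) with hlt | heq | hlt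
    · exact Or.inl hlt
    · exact Or.inr heq
    · exact absurd (rapidWeight_lt_of_decLT (x := y) (y := x) hlt) (not_lt.mpr h)

end RapidWeight

/-! ### Abel summation with decreasing coefficients -/

lemma sum_mul_sub_eq (a D : ℕ → ℚ) (h0 : D 0 = 0) (n : ℕ) :
    ∑ i ∈ Finset.range (n + 1), a i * (D (i + 1) - D i) =
      a n * D (n + 1) + ∑ i ∈ Finset.range n, (a i - a (i + 1)) * D (i + 1) := by
  induction n with
  | zero => simp [h0]
  | succ n ih =>
    rw [Finset.sum_range_succ, ih, Finset.sum_range_succ]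
    ring

lemma sum_mul_sub_nonneg {a D : ℕ → ℚ} {q : ℕ} (ha : ∀ i, i + 1 < q → a (i + 1) < a i)
    (hD : ∀ i ≤ q, 0 ≤ D i) (h0 : D 0 = 0) (hq : D q = 0) :
    0 ≤ ∑ i ∈ Finset.range q, a i * (D (i + 1) - D i) ∧
      (∑ i ∈ Finset.range q, a i * (D (i + 1) - D i) = 0 ↔ ∀ i ≤ q, D i = 0) := by
  cases q with
  | zero => simp [h0]
  | succ n =>
    rw [sum_mul_sub_eq a D h0, hq, mul_zero, zero_add]
    have hnn : ∀ i ∈ Finset.range n, 0 ≤ (a i - a (i + 1)) * D (i + 1) := fun i hi => by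
      rw [Finset.mem_range] at hi
      exact mul_nonneg (sub_pos.mpr (ha i (by omega))).le (hD _ (by omega))
    refine ⟨Finset.sum_nonneg hnn, ?_⟩
    rw [Finset.sum_eq_zero_iff_of_nonneg hnn]
    constructor
    · intro h i hi
      rcases i with _ | i
      · exact h0
      · rcases Nat.lt_or_ge i n with hin | hin
        · exact (mul_eq_zero.mp (h i (Finset.mem_range.mpr hin))).resolve_left
            (sub_pos.mpr (ha i (by omega))).ne'
        · rw [show i + 1 = n + 1 by omega]
          exact hq
    · intro h i hi
      rw [Finset.mem_range] at hi
      rw [h (i + 1) (by omega), mul_zero]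

/-! ### Minimizers of the weight -/

section Minimizers

variable {S : Type*} [Fintype S] [DecidableEq S] {p : Finset S → WithBot ℤ} {q : ℕ}
  {C : ℕ → Finset S} {c b : ℕ → ℤ}

omit [DecidableEq S] in
lemma le_sum_of_mem_integralPoints {m : S → ℤ} (hm : m ∈ integralPoints (basePolyhedron p))
    {Z : Finset S} {k : ℤ} (hk : p Z = k) : k ≤ ∑ s ∈ Z, m s := by
  have h := le_sum_of_mem_basePolyhedron (show _ ∈ basePolyhedron p from hm) hk.ge
  exact_mod_cast h

omit [DecidableEq S] in
lemma sum_eq_of_mem_integralPoints {m : S → ℤ} (hm : m ∈ integralPoints (basePolyhedron p))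
    {k : ℤ} (hk : p Finset.univ = k) : ∑ s, m s = k := by
  have h := sum_eq_of_mem_basePolyhedron (show _ ∈ basePolyhedron p from hm) hk
  exact_mod_cast h

namespace PeakChain

/-- The minimum of `rapidWeight` over the integral points of `B'(p)`. -/
noncomputable def minWeight (h : PeakChain p q C c b) : ℚ :=
  ∑ s, (((Fintype.card S : ℚ) + 1) ^ (b (h.index s) - 1) -
      (Fintype.card S : ℚ) * ((Fintype.card S : ℚ) + 1) ^ (b (h.index s) - 1) *
        (b (h.index s) - 1)) +
    ∑ i ∈ Finset.range q, (Fintype.card S : ℚ) * ((Fintype.card S : ℚ) + 1) ^ (b i - 1) *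
      (c (i + 1) - c i)

/-- Tightness of the chain together with the box constraints. -/
def IsBullet (_ : PeakChain p q C c b) (m : S → ℤ) : Prop :=
  (∀ i ≤ q, ∑ s ∈ C i, m s = c i) ∧
    ∀ i < q, ∀ s ∈ C (i + 1) \ C i, b i - 1 ≤ m s ∧ m s ≤ b i

lemma minWeight_le [Nonempty S] (h : PeakChain p q C c b) (hp : IsSupermodular p) {m : S → ℤ}
    (hm : m ∈ integralPoints (basePolyhedron p)) :
    h.minWeight ≤ rapidWeight m ∧ (rapidWeight m = h.minWeight ↔ h.IsBullet m) := by
  set n : ℚ := (Fintype.card S : ℚ) with hn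
  have hn1 : 1 ≤ n := by
    rw [hn, Nat.one_le_cast]
    exact Fintype.card_pos
  have hK : 2 ≤ n + 1 := by linarith
  have hK0 : n + 1 ≠ 0 := by linarith
  -- The chord through b i - 1 and b i has slope a i; D i is the excess of m over tightness on C i,
  -- and e s the gap between the weight of m s and the chord.
  set a : ℕ → ℚ := fun i => n * (n + 1) ^ (b i - 1) with ha
  set D : ℕ → ℚ := fun i => ∑ s ∈ C i, (m s : ℚ) - c i with hD
  set e : S → ℚ := fun s => (n + 1) ^ m s - (n + 1) ^ (b (h.index s) - 1) -
    a (h.index s) * (m s - (b (h.index s) - 1)) with he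
  have hscale : ∀ s, e s = (n + 1) ^ (b (h.index s) - 1) *
      ((n + 1) ^ (m s - (b (h.index s) - 1)) -
        (1 + (n + 1 - 1) * ((m s - (b (h.index s) - 1) : ℤ) : ℚ))) := fun s => by
    have : (n + 1) ^ m s = (n + 1) ^ (b (h.index s) - 1) *
        (n + 1) ^ (m s - (b (h.index s) - 1)) := by
      rw [← zpow_add₀ hK0, add_sub_cancel]
    simp only [he, ha]
    rw [this]
    push_cast
    ring
  have he0 : ∀ s ∈ (Finset.univ : Finset S), 0 ≤ e s := fun s _ => by
    rw [hscale]
    exact mul_nonneg (zpow_nonneg (by linarith) _) (sub_nonneg.mpr (one_add_mul_le_zpow hK _))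
  have hez : ∀ s, e s = 0 ↔ b (h.index s) - 1 ≤ m s ∧ m s ≤ b (h.index s) := fun s => by
    rw [hscale, mul_eq_zero, or_iff_right (zpow_ne_zero _ hK0), sub_eq_zero, eq_comm,
      one_add_mul_eq_zpow_iff hK]
    omega
  have hanti : ∀ i, i + 1 < q → a (i + 1) < a i := fun i hi => by
    have := zpow_lt_zpow_right₀ (by linarith : 1 < n + 1)
      (sub_lt_sub_right (h.anti i hi) 1)
    simp only [ha]
    gcongr
  have hD0 : ∀ i ≤ q, 0 ≤ D i := fun i _ => by
    have := le_sum_of_mem_integralPoints hm (h.map_eq i)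
    simp only [hD, sub_nonneg]
    exact_mod_cast this
  have hDz : D 0 = 0 := by simp [hD, h.zero, h.c_zero hp]
  have hDq : D q = 0 := by
    have := sum_eq_of_mem_integralPoints hm h.map_univ
    simp only [hD, h.last, sub_eq_zero]
    exact_mod_cast this
  obtain ⟨hA, hAz⟩ := sum_mul_sub_nonneg hanti hD0 hDz hDq
  have hsplit : ∑ s, a (h.index s) * (m s : ℚ) =
      ∑ i ∈ Finset.range q, a i * (∑ s ∈ C (i + 1), (m s : ℚ) - ∑ s ∈ C i, (m s : ℚ)) := by
    rw [← h.sum_inter_sdiff]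
    refine Finset.sum_congr rfl fun i hi => ?_
    rw [Finset.univ_inter, h.sum_index_eq (fun s i => a i * (m s : ℚ)) (Finset.mem_range.mp hi)
      subset_rfl, ← Finset.mul_sum, Finset.sum_sdiff_eq_sub (h.mono i.le_succ)]
  -- The weight exceeds the constant by two nonnegative amounts: the first vanishes exactly in the
  -- box, the second exactly when the chain is tight.
  have hdiff : rapidWeight m = h.minWeight + (∑ s, e s +
      ∑ i ∈ Finset.range q, a i * (D (i + 1) - D i)) := by
    have h1 : ∑ i ∈ Finset.range q, a i * (D (i + 1) - D i) =
        ∑ s, a (h.index s) * (m s : ℚ) - ∑ i ∈ Finset.range q, a i * (c (i + 1) - c i) := by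
      rw [hsplit, ← Finset.sum_sub_distrib]
      refine Finset.sum_congr rfl fun i _ => ?_
      simp only [hD]
      ring
    rw [h1, minWeight, rapidWeight, ← hn]
    have h2 : ∑ s, (n + 1) ^ m s = ∑ s, ((n + 1) ^ (b (h.index s) - 1) -
        n * (n + 1) ^ (b (h.index s) - 1) * (b (h.index s) - 1)) + ∑ s, e s +
        ∑ s, a (h.index s) * (m s : ℚ) := by
      rw [← Finset.sum_add_distrib, ← Finset.sum_add_distrib]
      refine Finset.sum_congr rfl fun s _ => ?_
      simp only [he, ha]
      ring
    rw [h2]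
    simp only [ha]
    ring
  have hE := Finset.sum_nonneg he0
  refine ⟨by linarith, ?_⟩
  have hiff : rapidWeight m = h.minWeight ↔
      (∑ s, e s) = 0 ∧ ∑ i ∈ Finset.range q, a i * (D (i + 1) - D i) = 0 := by
    constructor
    · intro hh
      constructor <;> linarith
    · rintro ⟨h1, h2⟩
      rw [hdiff, h1, h2, add_zero, add_zero]
  rw [hiff, hAz, Finset.sum_eq_zero_iff_of_nonneg he0, IsBullet, and_comm]
  refine and_congr (forall₂_congr fun i _ => ?_) ⟨fun hh i hi s hs => ?_, fun hh s _ => ?_⟩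
  · simp only [hD, sub_eq_zero]
    exact_mod_cast Iff.rfl
  · have := (hez s).mp (hh s (Finset.mem_univ s))
    rwa [h.index_eq hi hs] at this
  · exact (hez s).mpr (hh _ (h.index_lt s) s (h.mem_index s))

lemma mem_integralPoints_bulletFun (h : PeakChain p q C c b) (hp : IsSupermodular p) {m : S → ℤ} :
    m ∈ integralPoints (basePolyhedron h.bulletFun) ↔
      m ∈ integralPoints (basePolyhedron p) ∧ h.IsBullet m := by
  rw [h.basePolyhedron_bulletFun hp]
  simp only [integralPoints, Set.mem_ofPred_eq, IsBullet, and_assoc]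
  exact_mod_cast Iff.rfl

theorem mem_decMinSet_iff [Nonempty S] (h : PeakChain p q C c b) (hp : IsSupermodular p)
    {m : S → ℤ} : m ∈ decMinSet (integralPoints (basePolyhedron p)) ↔
      m ∈ integralPoints (basePolyhedron p) ∧ h.IsBullet m := by
  -- An integral point of the face within the box shows that the lower bound is attained.
  obtain ⟨m₀, hm₀⟩ := exists_integer_base (h.isSupermodular_bulletFun hp) (h.bulletFun_ne_bot hp)
  rw [h.mem_integralPoints_bulletFun hp] at hm₀
  have hw₀ := (h.minWeight_le hp hm₀.1).2.mpr hm₀.2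
  refine and_congr_right fun hm => ?_
  simp only [decLE_iff_rapidWeight_le]
  obtain ⟨hle, hiff⟩ := h.minWeight_le hp hm
  rw [← hiff]
  refine ⟨fun hmin => le_antisymm ((hmin m₀ hm₀.1).trans hw₀.le) hle, fun heq y hy => ?_⟩
  rw [heq]
  exact (h.minWeight_le hp hy).1

end PeakChain

end Minimizers

/-! ### Translation to the canonical partition and to restrictions -/

section Parts

variable {S : Type*} [Fintype S] [DecidableEq S] {p : Finset S → WithBot ℤ}

lemma map_canonicalChain_eq_coe (hp : IsSupermodular p) (i : ℕ) :
    p (canonicalChain p i) = (((p (canonicalChain p i)).unbotD 0 : ℤ) : WithBot ℤ) :=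
  (peakChain_canonical hp).map_eq i

lemma bulletPolyhedron_eq (hp : IsSupermodular p) :
    bulletPolyhedron p = basePolyhedron (peakChain_canonical hp).bulletFun := by
  rw [(peakChain_canonical hp).basePolyhedron_bulletFun hp]
  ext x
  refine and_congr (and_congr_right fun _ => ?_) Iff.rfl
  have hc : ∀ i, ((∑ s ∈ canonicalChain p i, x s : ℝ) : WithBot ℝ) =
      (p (canonicalChain p i)).map (fun k : ℤ => (k : ℝ)) ↔
      ∑ s ∈ canonicalChain p i, x s = ((p (canonicalChain p i)).unbotD 0 : ℤ) := fun i => by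
    conv_lhs => rw [map_canonicalChain_eq_coe hp i, WithBot.map_coe, WithBot.coe_inj]
  simp only [hc]
  refine ⟨fun h i hi => ?_, fun h i hi => h (i + 1) hi⟩
  -- Tightness is demanded only from C_1 on; for C_0 = ∅ it is automatic.
  rcases i with _ | i
  · simp [canonicalChain, hp.map_empty]
  · exact h i hi

lemma forall_isTight_and_iff_isBullet (hp : IsSupermodular p) (m : S → ℤ) :
    (∀ i < canonicalLength p, IsTight p m (canonicalChain p (i + 1)) ∧
      ∀ s ∈ canonicalPart p i, essentialValue p i - 1 ≤ m s ∧ m s ≤ essentialValue p i) ↔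
      (peakChain_canonical hp).IsBullet m := by
  have hc : ∀ i, IsTight p m (canonicalChain p i) ↔
      ∑ s ∈ canonicalChain p i, m s = (p (canonicalChain p i)).unbotD 0 := fun i => by
    conv_lhs => rw [IsTight, map_canonicalChain_eq_coe hp i, WithBot.coe_inj]
  simp only [hc, PeakChain.IsBullet]
  refine ⟨fun h => ⟨fun i hi => ?_, fun i hi => (h i hi).2⟩,
    fun h i hi => ⟨h.1 (i + 1) hi, h.2 i hi⟩⟩
  rcases i with _ | i
  · simp [canonicalChain, hp.map_empty]
  · exact (h i hi).1

lemma partFun_eq_coe_iff {i : ℕ} {k : ℤ}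
    (X : Finset {s : S // s ∈ canonicalPart p i}) :
    partFun p i X = k ↔ p (X.map (Function.Embedding.subtype _) ∪ canonicalChain p i) =
      ((k + (p (canonicalChain p i)).unbotD 0 : ℤ) : WithBot ℤ) := by
  rw [partFun, map_sub_eq_add]
  cases p (X.map (Function.Embedding.subtype _) ∪ canonicalChain p i) with
  | bot => simp only [WithBot.bot_add, WithBot.bot_ne_coe]
  | coe j =>
    rw [← WithBot.coe_add, WithBot.coe_inj, WithBot.coe_inj]
    constructor <;> intro h <;> omega

lemma partFun_univ (hp : IsSupermodular p) (i : ℕ) :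
    partFun p i Finset.univ = (((p (canonicalChain p (i + 1))).unbotD 0 -
      (p (canonicalChain p i)).unbotD 0 : ℤ) : WithBot ℤ) := by
  have h : (Finset.univ : Finset {s : S // s ∈ canonicalPart p i}).map
      (Function.Embedding.subtype _) ∪ canonicalChain p i = canonicalChain p (i + 1) := by
    rw [← Finset.attach_eq_univ, Finset.attach_map_val, canonicalPart,
      Finset.sdiff_union_of_subset (monotone_canonicalChain p i.le_succ)]
  rw [partFun_eq_coe_iff, h, sub_add_cancel]
  exact map_canonicalChain_eq_coe hp _

lemma restrict_mem_basePolyhedron_partFun_iff (hp : IsSupermodular p) (i : ℕ) (x : S → ℝ) :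
    (fun s : {s : S // s ∈ canonicalPart p i} => x s) ∈ basePolyhedron (partFun p i) ↔
      ∑ s ∈ canonicalPart p i, x s = ((p (canonicalChain p (i + 1))).unbotD 0 : ℤ) -
        ((p (canonicalChain p i)).unbotD 0 : ℤ) ∧
      ∀ (X : Finset S) (k : ℤ), X ⊆ canonicalPart p i → p (X ∪ canonicalChain p i) = k →
        (k : ℝ) - ((p (canonicalChain p i)).unbotD 0 : ℤ) ≤ ∑ s ∈ X, x s := by
  have hu := partFun_univ hp i
  rw [mem_basePolyhedron_iff (by rw [hu]; exact WithBot.coe_ne_bot)]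
  refine and_congr ?_ ⟨fun h X k hX hk => ?_, fun h Z k hk => ?_⟩
  · rw [Finset.univ_eq_attach, Finset.sum_attach (canonicalPart p i) x, ← Finset.univ_eq_attach, hu]
    constructor
    · intro h
      have := h _ rfl
      exact_mod_cast this
    · intro h k hk
      rw [h, ← WithBot.coe_injective hk]
      push_cast
      rfl
  · obtain ⟨Y, rfl⟩ : ∃ Y : Finset {s : S // s ∈ canonicalPart p i},
        Y.map (Function.Embedding.subtype _) = X :=
      ⟨X.subtype _, by
        rw [Finset.subtype_map, Finset.filter_eq_self]
        exact fun s hs => hX hs⟩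
    have := h Y (k - (p (canonicalChain p i)).unbotD 0)
      ((partFun_eq_coe_iff Y).mpr (by rw [hk, sub_add_cancel]))
    rw [Finset.sum_map]
    exact_mod_cast this
  · have := h _ _ (fun s hs => by
      obtain ⟨t, _, rfl⟩ := Finset.mem_map.mp hs
      exact t.2) ((partFun_eq_coe_iff Z).mp hk)
    rw [Finset.sum_map] at this
    push_cast at this
    rw [add_sub_cancel_right] at this
    exact this

/-- The face is the direct sum of the B_i: the totals over the parts telescope to p(S), and the
inequalities of the minors add up to those of the face. -/
lemma forall_restrict_mem_iff (hp : IsSupermodular p) (x : S → ℝ) :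
    (∀ i < canonicalLength p, (fun s : {s : S // s ∈ canonicalPart p i} => x s) ∈
      basePolyhedron (partFun p i) ∩ partBox p i) ↔ x ∈ bulletPolyhedron p := by
  have h := peakChain_canonical hp
  rw [bulletPolyhedron_eq hp, h.basePolyhedron_bulletFun hp, Set.mem_ofPred_eq]
  simp only [Set.mem_inter_iff, restrict_mem_basePolyhedron_partFun_iff hp]
  have hbox : ∀ i, (fun s : {s : S // s ∈ canonicalPart p i} => x s) ∈ partBox p i ↔
      ∀ s ∈ canonicalPart p i, (essentialValue p i : ℝ) - 1 ≤ x s ∧ x s ≤ essentialValue p i :=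
    fun i => Subtype.forall
  simp only [hbox]
  constructor
  · intro hx
    refine ⟨?_, fun i hi => (hx i hi).2⟩
    have hmem : x ∈ basePolyhedron (faceFun p (canonicalLength p) (canonicalChain p)
        (fun i => (p (canonicalChain p i)).unbotD 0)) := by
      refine h.mem_basePolyhedron_faceFun_of_forall hp ?_ fun i hi => (hx i hi).1.2
      have hpart : ∀ i ∈ Finset.range (canonicalLength p),
          ∑ s ∈ Finset.univ ∩ (canonicalChain p (i + 1) \ canonicalChain p i), x s =
            ((p (canonicalChain p (i + 1))).unbotD 0 : ℤ) -
              ((p (canonicalChain p i)).unbotD 0 : ℤ) := fun i hi => by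
        rw [Finset.univ_inter]
        exact (hx i (Finset.mem_range.mp hi)).1.1
      rw [← h.sum_inter_sdiff, Finset.sum_congr rfl hpart,
        Finset.sum_range_sub (fun i => (((p (canonicalChain p i)).unbotD 0 : ℤ) : ℝ)), h.c_zero hp,
        Int.cast_zero, sub_zero]
    rw [h.basePolyhedron_faceFun hp] at hmem
    exact hmem
  · rintro ⟨⟨hB, ht⟩, hb⟩ i hi
    refine ⟨⟨?_, fun X k hX hk => ?_⟩, hb i hi⟩
    · rw [canonicalPart, Finset.sum_sdiff_eq_sub (h.mono i.le_succ), ht _ hi, ht _ hi.le]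
    · have h1 := le_sum_of_mem_basePolyhedron hB hk.ge
      rw [Finset.sum_union (Finset.disjoint_of_subset_left hX Finset.sdiff_disjoint),
        ht i hi.le] at h1
      linarith

end Parts

end DecMin

theorem theorem5p1 {S : Type*} [Fintype S] [DecidableEq S] [Nonempty S]
    (p : Finset S → WithBot ℤ) (hp : DecMin.IsSupermodular p) :
    -- the iteration terminates, and yields a partition into non-empty sets and decreasing values
    (DecMin.canonicalChain p (DecMin.canonicalLength p) = Finset.univ ∧
      (∀ i < DecMin.canonicalLength p, (DecMin.canonicalPart p i).Nonempty) ∧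
      (∀ s : S, ∃! i : ℕ, i < DecMin.canonicalLength p ∧ s ∈ DecMin.canonicalPart p i) ∧
      StrictAntiOn (DecMin.essentialValue p) (Set.Iio (DecMin.canonicalLength p))) ∧
    -- the dec-min elements are the integral points of `B^•`, and they form an M-convex set
    DecMin.decMinSet (DecMin.integralPoints (DecMin.basePolyhedron p)) =
      DecMin.integralPoints (DecMin.bulletPolyhedron p) ∧
    DecMin.IsIntegralBasePolyhedron (DecMin.bulletPolyhedron p) ∧
    DecMin.IsMConvexSet (DecMin.integralPoints (DecMin.bulletPolyhedron p)) ∧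
    -- description by the restrictions to the members of the canonical partition
    (∀ m : S → ℤ,
      m ∈ DecMin.decMinSet (DecMin.integralPoints (DecMin.basePolyhedron p)) ↔
        ∀ i < DecMin.canonicalLength p,
          (fun s : {s : S // s ∈ DecMin.canonicalPart p i} => (m s : ℝ)) ∈
            DecMin.basePolyhedron (DecMin.partFun p i) ∩ DecMin.partBox p i) ∧
    -- description by tightness of the canonical chain
    (∀ m ∈ DecMin.integralPoints (DecMin.basePolyhedron p),
      (m ∈ DecMin.decMinSet (DecMin.integralPoints (DecMin.basePolyhedron p)) ↔
        ∀ i < DecMin.canonicalLength p,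
          DecMin.IsTight p m (DecMin.canonicalChain p (i + 1)) ∧
          ∀ s ∈ DecMin.canonicalPart p i,
            DecMin.essentialValue p i - 1 ≤ m s ∧ m s ≤ DecMin.essentialValue p i)) := by

  have h := DecMin.peakChain_canonical hp
  have hdec : DecMin.decMinSet (DecMin.integralPoints (DecMin.basePolyhedron p)) =
      DecMin.integralPoints (DecMin.bulletPolyhedron p) := by
    ext m
    rw [h.mem_decMinSet_iff hp, DecMin.bulletPolyhedron_eq hp, h.mem_integralPoints_bulletFun hp]
  have hint : DecMin.IsIntegralBasePolyhedron (DecMin.bulletPolyhedron p) :=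
    ⟨_, h.isSupermodular_bulletFun hp, DecMin.bulletPolyhedron_eq hp⟩
  refine ⟨⟨h.last, fun i hi => DecMin.canonicalPart_nonempty hp (DecMin.canonicalChain_ne_univ hi),
    h.existsUnique_index, h.strictAntiOn⟩, hdec, hint, ⟨_, hint, rfl⟩, fun m => ?_, fun m hm => ?_⟩
  · rw [hdec]
    exact (DecMin.forall_restrict_mem_iff hp fun s => (m s : ℝ)).symm
  · rw [h.mem_decMinSet_iff hp, and_iff_right hm, DecMin.forall_isTight_and_iff_isBullet hp]
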